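/- For a nonnegative integer or half-integer $J$ let $\mathcal H_J=\mathbb C^{2J+1}$ be the spin $J$ representation space of $SU(2)$ with spin operators $\mathbf S_J=(S_x,S_y,S_z)$. For $\omega$ in the unit sphere $\mathbb S^2\subset\mathbb R^3$ let $P^J_\omega=|\omega\rangle\langle\omega|$ be the coherent state projection, i.e. the orthogonal projection of $\mathcal H_J$ onto the (one-dimensional) eigenspace of $\omega\cdot\mathbf S_J$ with eigenvalue $J$. A density matrix is a positive semi-definite operator of trace $1$. For nonnegative integers or half-integers $J,K$, put $k=2K-2J\in\mathbb Z$, let $P_-$ be the orthogonal projection in $\mathcal H_J\otimes\mathcal H_K$ onto the subspace of minimal total spin $|K-J|$, and define, for operators $\rho$ on $\mathcal H_J$, $$\Phi^k(\rho)=\frac{2J+1}{2|K-J|+1}\,\mathrm{Tr}_J\big(P_-(\rho\otimes I_K)\big),$$ an operator on $\mathcal H_K$, where $\mathrm{Tr}_J$ is the partial trace over $\mathcal H_J$. Then $P^J_\omega$ is a density matrix for every $\omega\in\mathbb S^2$, and $\Phi^k$ maps density matrices to density matrices. For every concave $f:[0,1]\to\mathbb R$, every density matrix $\rho$ on $\mathcal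 H_J$ and every $\omega\in\mathbb S^2$, $$\mathrm{Tr}_K\big[f(\Phi^k(\rho))\big]\ \ge\ \mathrm{Tr}_K\big[f(\Phi^k(|\omega\rangle\langle\omega|))\big].$$ In particular, with the von Neumann entropy $S(\sigma)=-\mathrm{Tr}(\sigma\ln\sigma)$ (and $0\ln 0=0$), for every $\omega\in\mathbb S^2$, $$\min_{\rho}S(\Phi^k(\rho))=S(\Phi^k(|\omega\rangle\langle\omega|)),$$ the minimum being over all density matrices $\rho$ on $\mathcal H_J$. -/

import Mathlib

open scoped Kronecker ComplexOrder

noncomputable section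

namespace SpinChannel

/-! Spins are labelled by the natural numbers `a = 2J` and `b = 2K`, so that the spin `J`
representation space of `SU(2)` is `ℂ^(a+1)`. Its standard orthonormal basis vector with index `i`,
for `0 ≤ i ≤ a`, is `|M⟩` with `M = J - i = a/2 - i`. Operators are matrices in that basis. -/

/-- The operator `S_z` of spin `a/2`: `S_z |M⟩ = M |M⟩`. -/
def spinZ (a : ℕ) : Matrix (Fin (a + 1)) (Fin (a + 1)) ℂ :=
  Matrix.diagonal fun i => (a : ℂ) / 2 - (i : ℕ)

/-- The raising operator `S_+` of spin `J = a/2`: `S_+ |M⟩ = √((J - M) (J + M + 1)) |M + 1⟩`.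
For `M = J - j` one has `J - M = j` and `J + M + 1 = a + 1 - j`. -/
def spinPlus (a : ℕ) : Matrix (Fin (a + 1)) (Fin (a + 1)) ℂ :=
  Matrix.of fun i j =>
    if (i : ℕ) + 1 = j then ((Real.sqrt (((j : ℕ) : ℝ) * ((a : ℝ) + 1 - (j : ℕ))) : ℝ) : ℂ) else 0

/-- The lowering operator `S_- = S_+^*`. -/
def spinMinus (a : ℕ) : Matrix (Fin (a + 1)) (Fin (a + 1)) ℂ :=
  (spinPlus a).conjTranspose

/-- The operator `S_x = (S_+ + S_-) / 2`. -/
def spinX (a : ℕ) : Matrix (Fin (a + 1)) (Fin (a + 1)) ℂ :=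
  (1 / 2 : ℂ) • (spinPlus a + spinMinus a)

/-- The operator `S_y = (S_+ - S_-) / (2 i)`. -/
def spinY (a : ℕ) : Matrix (Fin (a + 1)) (Fin (a + 1)) ℂ :=
  (1 / (2 * Complex.I) : ℂ) • (spinPlus a - spinMinus a)

/-- The matrix of the orthogonal projection onto the eigenspace of `A` for the eigenvalue `μ`. -/
def eigenProj {n : Type*} [Fintype n] [DecidableEq n] (A : Matrix n n ℂ) (μ : ℂ) : Matrix n n ℂ :=
  (Matrix.toEuclideanCLM (n := n) (𝕜 := ℂ)).symm
    (Module.End.eigenspace (Matrix.toEuclideanLin A) μ).starProjection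

/-- The coherent state projection `P_ω = |ω⟩⟨ω|` of spin `J = a/2`, for `ω` in the unit sphere of
`ℝ³`: the projection onto the eigenspace of `ω · S` for the eigenvalue `J`. -/
def coherentProj (a : ℕ) (ω : Metric.sphere (0 : EuclideanSpace ℝ (Fin 3)) 1) :
    Matrix (Fin (a + 1)) (Fin (a + 1)) ℂ :=
  eigenProj
    (((ω.1 0 : ℝ) : ℂ) • spinX a + ((ω.1 1 : ℝ) : ℂ) • spinY a + ((ω.1 2 : ℝ) : ℂ) • spinZ a)
    ((a : ℂ) / 2)

/-- A component of the total spin on the tensor product of two spin spaces, namely `S ⊗ I + I ⊗ T`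
where `S` and `T` are the corresponding components of the two spins. -/
def totalSpin {a b : ℕ} (S : Matrix (Fin (a + 1)) (Fin (a + 1)) ℂ)
    (T : Matrix (Fin (b + 1)) (Fin (b + 1)) ℂ) :
    Matrix (Fin (a + 1) × Fin (b + 1)) (Fin (a + 1) × Fin (b + 1)) ℂ :=
  S ⊗ₖ (1 : Matrix (Fin (b + 1)) (Fin (b + 1)) ℂ) +
    (1 : Matrix (Fin (a + 1)) (Fin (a + 1)) ℂ) ⊗ₖ T

/-- The square `S_x² + S_y² + S_z²` of the total spin on the tensor product. -/
def totalSpinSq (a b : ℕ) :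
    Matrix (Fin (a + 1) × Fin (b + 1)) (Fin (a + 1) × Fin (b + 1)) ℂ :=
  totalSpin (spinX a) (spinX b) ^ 2 + totalSpin (spinY a) (spinY b) ^ 2 +
    totalSpin (spinZ a) (spinZ b) ^ 2

/-- The minimal total spin `|K - J|` of a spin `J = a/2` and a spin `K = b/2`. -/
def minSpin (a b : ℕ) : ℝ := |(b : ℝ) / 2 - (a : ℝ) / 2|

/-- The projection `P_-` onto the vectors of minimal total spin `s = |K - J|`, that is, onto the
eigenspace of the square of the total spin for the eigenvalue `s (s + 1)`. -/
def projMinus (a b : ℕ) :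
    Matrix (Fin (a + 1) × Fin (b + 1)) (Fin (a + 1) × Fin (b + 1)) ℂ :=
  eigenProj (totalSpinSq a b) ((minSpin a b * (minSpin a b + 1) : ℝ) : ℂ)

/-- The partial trace over the first tensor factor. -/
def partialTraceLeft {m n : Type*} [Fintype m] (A : Matrix (m × n) (m × n) ℂ) : Matrix n n ℂ :=
  Matrix.of fun k l => ∑ j, A (j, k) (j, l)

/-- The quantum coherent operator channel from spin `J = a/2` to spin `K = b/2`:
`Φ(ρ) = (2J+1) / (2|K-J|+1) Tr_J (P_- (ρ ⊗ I_K))`. -/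
def channel (a b : ℕ) (ρ : Matrix (Fin (a + 1)) (Fin (a + 1)) ℂ) :
    Matrix (Fin (b + 1)) (Fin (b + 1)) ℂ :=
  ((((a : ℝ) + 1) / (2 * minSpin a b + 1) : ℝ) : ℂ) •
    partialTraceLeft (projMinus a b * (ρ ⊗ₖ (1 : Matrix (Fin (b + 1)) (Fin (b + 1)) ℂ)))

/-- Density matrices: positive semi-definite with trace one. -/
def IsDensity {n : Type*} [Fintype n] (ρ : Matrix n n ℂ) : Prop :=
  ρ.PosSemidef ∧ ρ.trace = 1

/-- `Tr f(A)` for a Hermitian matrix `A`, with `f(A)` given by the functional calculus. The spectrum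
is finite, so every `f` is continuous on it, and `f(A)` is Hermitian, so its trace is real. -/
def traceFun {n : Type*} [Fintype n] [DecidableEq n] (f : ℝ → ℝ) (A : Matrix n n ℂ) : ℝ :=
  (cfc f A).trace.re

/-- The von Neumann entropy `S(ρ) = -Tr (ρ ln ρ)`, with the convention `0 ln 0 = 0`. -/
def entropy {n : Type*} [Fintype n] [DecidableEq n] (ρ : Matrix n n ℂ) : ℝ :=
  traceFun (fun t => -(t * Real.log t)) ρ

end SpinChannel

end

/-! Write `a = 2J`, `b = 2K` and regard spin `a/2` as `a` bosons distributed over two modes. The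
vectors of minimal total spin form the kernel of the polarization operator
(`conjTranspose_mul_polarization`), which yields an explicit orthogonal basis of them and hence a
Kraus form of the channel: up to normalization and time reversal it adds `b - a` bosons if `a ≤ b`
(`channel_of_le`) and removes `a - b` bosons if `b ≤ a` (`channel_of_ge`).

The inequality for all concave `f` is a majorization statement: for every `n`, the sum of the `n`
largest eigenvalues of an output is at most the corresponding sum for a coherent state. Ky Fan's
principle expresses these sums (`TopSumLe`) and Karamata's inequality passes to `f`. Rotation
covariance (`IsSpinRotation.channel_conj`) makes the output spectrum of a coherent state independent
of `ω`, so the highest weight state suffices. If `b ≤ a`, its output is pure and majorizes every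
density matrix.

Let `a ≤ b` and `k = b - a`. Ky Fan bounds add up, so the input may be taken pure, `|v⟩⟨v|`. The
output is then `V Vᴴ`, where the columns of `V` are the images of `v` under the Kraus operators, and
it has the nonzero spectrum of the Gram matrix `Vᴴ V`, whose size `k + 1` depends on `k` alone. The
entries of `Vᴴ V` are expectations in `v` of annihilation operators times creation operators. Normal
ordering (`sum_krausCoeff_mul`) turns `Vᴴ V` into the sum over `l ≤ min a k` of the reduction of
`|v⟩⟨v|` to `l` bosons, amplified to `k` bosons. Each such term adds only `k - l` bosons, so strong
induction on `k` applies for `l ≥ 1`, while `l = 0` gives a multiple of the identity. The reductions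
have trace `a.choose l` times that of `|v⟩⟨v|`, and by Vandermonde's identity
(`sum_choose_mul_coherentWeight`) the bounds add up exactly to the coherent spectrum. -/

noncomputable section

namespace SpinChannel

section

open Finset Matrix

/-! ### Karamata's inequality -/

/-- A concave function on the unit interval has a supergradient at each interior point. -/
theorem exists_supergradient {f : ℝ → ℝ} (hf : ConcaveOn ℝ (Set.Icc 0 1) f) :
    ∃ s : ℝ → ℝ, (∀ x ∈ Set.Ioo (0 : ℝ) 1, ∀ y ∈ Set.Icc (0 : ℝ) 1,
      f y ≤ f x + s x * (y - x)) ∧ AntitoneOn s (Set.Ioo 0 1) := by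
  have hg : ConvexOn ℝ (Set.Icc 0 1) (-f) := hf.neg
  -- This is the right derivative of `f`, which exists at interior points without differentiability
  -- of `f`.
  refine ⟨fun x => -derivWithin (-f) (Set.Ioi x) x, ?_, ?_⟩
  · intro x hx y hy
    have hxi : x ∈ interior (Set.Icc (0 : ℝ) 1) := by rwa [interior_Icc]
    rcases lt_trichotomy y x with h | rfl | h
    · have h1 := hg.slope_le_leftDeriv_of_mem_interior hy hxi h
      have h2 := h1.trans (hg.leftDeriv_le_rightDeriv_of_mem_interior hxi)
      rw [slope_def_field, div_le_iff₀ (by linarith)] at h2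
      simp only [Pi.neg_apply] at h2
      linarith
    · simp
    · have h2 := hg.rightDeriv_le_slope_of_mem_interior hxi hy h
      rw [slope_def_field, le_div_iff₀ (by linarith)] at h2
      simp only [Pi.neg_apply] at h2
      linarith
  · have := hg.monotoneOn_rightDeriv
    rw [interior_Icc] at this
    exact this.neg

/-- Abel summation in the form of an induction: raising the last weight from `s n` to `s (n + 1)`
only increases the bound, since the partial sum it multiplies is nonnegative. -/
theorem sum_mul_nonpos_of_partial_sums {N : ℕ} {s d : ℕ → ℝ}
    (hs : ∀ i j, i ≤ j → j < N → s i ≤ s j)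
    (hd : ∀ n ≤ N, 0 ≤ ∑ i ∈ range n, d i) (h0 : ∑ i ∈ range N, d i = 0) :
    ∑ i ∈ range N, s i * d i ≤ 0 := by
  have key : ∀ n, n + 1 ≤ N →
      ∑ i ∈ range (n + 1), s i * d i ≤ s n * ∑ i ∈ range (n + 1), d i := by
    intro n
    induction n with
    | zero => intro _; simp
    | succ n ih =>
      intro hn
      rw [sum_range_succ, sum_range_succ _ (n + 1), mul_add]
      have h1 := ih (by omega)
      have h2 := mul_le_mul_of_nonneg_right (hs n (n + 1) (by omega) (by omega))
        (hd (n + 1) (by omega))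
      linarith
  rcases N with _ | n
  · simp
  · have := key n le_rfl
    rwa [h0, mul_zero] at this

/-- Karamata's inequality for a concave function on the unit interval. -/
theorem karamata {f : ℝ → ℝ} (hf : ConcaveOn ℝ (Set.Icc 0 1) f) {N : ℕ} {x y : ℕ → ℝ}
    (hx : ∀ i < N, x i ∈ Set.Icc (0 : ℝ) 1) (hy : ∀ i < N, y i ∈ Set.Icc (0 : ℝ) 1)
    (hanti : ∀ i j, i ≤ j → j < N → x j ≤ x i)
    (hle : ∀ n ≤ N, ∑ i ∈ range n, x i ≤ ∑ i ∈ range n, y i)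
    (heq : ∑ i ∈ range N, x i = ∑ i ∈ range N, y i) :
    ∑ i ∈ range N, f (y i) ≤ ∑ i ∈ range N, f (x i) := by
  obtain ⟨s, hs, hsm⟩ := exists_supergradient hf
  set B := ∑ i ∈ range N, |s (x i)| with hB
  have hBle : ∀ i < N, |s (x i)| ≤ B := fun i hi =>
    single_le_sum (f := fun i => |s (x i)|) (fun _ _ => abs_nonneg _) (mem_range.2 hi)
  have hB0 : 0 ≤ B := sum_nonneg fun _ _ => abs_nonneg _
  -- At the endpoints `0` and `1` a finite supergradient may not exist, as for `-t ln t` at `0`. The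
  -- values `±B` keep `t` monotone, and they are harmless because `y i = x i` at those indices.
  set t : ℕ → ℝ := fun i => if x i ≤ 0 then B else if 1 ≤ x i then -B else s (x i) with ht
  have htm : ∀ i j, i ≤ j → j < N → t i ≤ t j := by
    intro i j hij hj
    have hxx := hanti i j hij hj
    have h1 := abs_le.1 (hBle i (by omega))
    have h2 := abs_le.1 (hBle j hj)
    simp only [ht]
    split_ifs with a1 a2 a3 a4 a5 a6 a7 a8 <;> try linarith
    exact hsm ⟨by linarith, by linarith⟩ ⟨by linarith, by linarith⟩ hxx
  -- From index `i` on `x` vanishes, so the tail of `y` has nonpositive sum and nonnegative terms.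
  -- The case `x i = 1` below is dual: the first `i + 1` terms of `y` are at most `1` and sum to at
  -- least `i + 1`.
  have hzero : ∀ i < N, x i ≤ 0 → y i = x i := by
    intro i hi h
    have hx0 : ∀ j ∈ range N \ range i, x j = 0 := by
      intro j hj
      simp only [mem_sdiff, mem_range, not_lt] at hj
      exact le_antisymm ((hanti i j hj.2 hj.1).trans h) (hx j hj.1).1
    have h3 := sum_sdiff (f := x) (range_subset_range.2 hi.le)
    have h4 := sum_sdiff (f := y) (range_subset_range.2 hi.le)
    rw [sum_congr rfl hx0, sum_const_zero] at h3
    have h5 := hle i hi.le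
    have h6 : ∑ j ∈ range N \ range i, y j ≤ 0 := by linarith
    have h7 := single_le_sum (f := y) (s := range N \ range i) (a := i)
      (fun j hj => (hy j (mem_range.1 (mem_sdiff.1 hj).1)).1) (by simp [hi])
    linarith [(hy i hi).1, (hx i hi).1]
  have hone : ∀ i < N, 1 ≤ x i → y i = x i := by
    intro i hi h
    have hx1 : ∀ j ∈ range (i + 1), x j = 1 := by
      intro j hj
      have hj' := mem_range.1 hj
      exact le_antisymm (hx j (by omega)).2 (h.trans (hanti j i (by omega) hi))
    have h5 := hle (i + 1) hi
    rw [sum_congr rfl hx1, sum_range_succ y] at h5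
    have h6 : ∑ j ∈ range i, y j ≤ ∑ j ∈ range i, (1 : ℝ) :=
      sum_le_sum fun j hj => (hy j ((mem_range.1 hj).trans hi)).2
    simp only [sum_const, card_range, nsmul_eq_mul, mul_one, Nat.cast_add, Nat.cast_one] at h5 h6
    linarith [(hy i hi).2, (hx i hi).2]
  have hterm : ∀ i < N, f (y i) ≤ f (x i) + t i * (y i - x i) := by
    intro i hi
    by_cases h0 : x i ≤ 0
    · simp [hzero i hi h0]
    by_cases h1 : 1 ≤ x i
    · simp [hone i hi h1]
    simp only [ht, if_neg h0, if_neg h1]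
    exact hs _ ⟨by linarith, by linarith⟩ _ (hy i hi)
  have hsum := sum_le_sum fun i hi => hterm i (mem_range.1 hi)
  have habel : ∑ i ∈ range N, t i * (y i - x i) ≤ 0 := by
    apply sum_mul_nonpos_of_partial_sums htm
    · intro n hn
      rw [sum_sub_distrib]
      linarith [hle n hn]
    · rw [sum_sub_distrib]
      linarith
  rw [sum_add_distrib] at hsum
  linarith

/-! ### Spectral sums -/

variable {n m : Type*} [Fintype n] [DecidableEq n] [Fintype m] [DecidableEq m]

/-- The trace of `f(A)` is the sum of `f` over the eigenvalues. -/
theorem traceFun_conj_diagonal (f : ℝ → ℝ) {W : Matrix n n ℂ} (hW : Wᴴ * W = 1) (d : n → ℝ) :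
    traceFun f (W * diagonal (fun i => (d i : ℂ)) * Wᴴ) = ∑ i, f (d i) := by
  set A := W * diagonal (fun i => (d i : ℂ)) * Wᴴ with hAdef
  have hA : A.IsHermitian := by
    rw [Matrix.IsHermitian, hAdef, conjTranspose_mul, conjTranspose_mul,
      conjTranspose_conjTranspose, diagonal_conjTranspose, Matrix.mul_assoc]
    congr 3
    ext i
    simp
  -- The two families of eigenvalues agree only up to order, so they are compared as multisets of
  -- roots of the characteristic polynomial.
  have hroots : Multiset.map (fun i => (hA.eigenvalues i : ℂ)) univ.val =
      Multiset.map (fun i => (d i : ℂ)) univ.val := by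
    have h := hA.roots_charpoly_eq_eigenvalues
    have h2 : A.charpoly = ∏ i, (Polynomial.X - Polynomial.C (d i : ℂ)) := by
      rw [hAdef, charpoly_mul_comm, ← Matrix.mul_assoc, hW, Matrix.one_mul, charpoly_diagonal]
    rw [h2, Polynomial.roots_prod _ _ (Finset.prod_ne_zero_iff.2
      fun i _ => Polynomial.X_sub_C_ne_zero _)] at h
    simp only [Polynomial.roots_X_sub_C, Multiset.bind_singleton] at h
    rw [h]
    rfl
  have h3 := congrArg (fun s => (Multiset.map (fun z : ℂ => f z.re) s).sum) hroots
  simp only [Multiset.map_map, Function.comp_def, Complex.ofReal_re] at h3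
  have h4 : traceFun f A = ∑ i, f (hA.eigenvalues i) := by
    rw [traceFun, hA.cfc_eq, IsHermitian.cfc, Unitary.conjStarAlgAut_apply, trace_mul_comm,
      ← Matrix.mul_assoc]
    simp [trace]
  rw [h4]
  exact h3

/-- A Hermitian matrix is diagonalized by a unitary with the eigenvalues in decreasing order. -/
theorem exists_sorted_diagonalization {N : ℕ} {A : Matrix (Fin N) (Fin N) ℂ}
    (hA : A.IsHermitian) :
    ∃ (W : Matrix (Fin N) (Fin N) ℂ) (d : Fin N → ℝ), Wᴴ * W = 1 ∧ W * Wᴴ = 1 ∧ Antitone d ∧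
      A = W * diagonal (fun i => (d i : ℂ)) * Wᴴ := by
  set σ := Tuple.sort (fun i => -hA.eigenvalues i)
  set U : Matrix (Fin N) (Fin N) ℂ := hA.eigenvectorUnitary.1
  have hU1 : Uᴴ * U = 1 := Unitary.coe_star_mul_self hA.eigenvectorUnitary
  refine ⟨U.submatrix id σ, hA.eigenvalues ∘ σ, ?_, ?_, ?_, ?_⟩
  · rw [conjTranspose_submatrix, ← submatrix_mul _ _ σ id σ Function.bijective_id, hU1]
    simp
  · rw [conjTranspose_submatrix, submatrix_mul_equiv]
    simpa using mul_eq_one_comm.1 hU1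
  · intro i j hij
    have := Tuple.monotone_sort (fun i => -hA.eigenvalues i) hij
    simp only [Function.comp_apply, neg_le_neg_iff] at this
    exact this
  · have h : diagonal (fun i => (((hA.eigenvalues ∘ σ) i : ℝ) : ℂ)) =
        (diagonal fun i => (hA.eigenvalues i : ℂ)).submatrix σ σ := by
      rw [submatrix_diagonal_equiv]
      rfl
    rw [h, conjTranspose_submatrix, submatrix_mul_equiv, submatrix_mul_equiv]
    simpa [U, Unitary.conjStarAlgAut_apply, Function.comp_def, star_eq_conjTranspose] using
      hA.spectral_theorem

theorem traceFun_unitary_conj (f : ℝ → ℝ) {N : ℕ} {A U : Matrix (Fin N) (Fin N) ℂ}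
    (hA : A.IsHermitian) (hU : Uᴴ * U = 1) : traceFun f (U * A * Uᴴ) = traceFun f A := by
  obtain ⟨W, d, hW, -, -, rfl⟩ := exists_sorted_diagonalization hA
  rw [traceFun_conj_diagonal f hW]
  have : U * (W * diagonal (fun i => (d i : ℂ)) * Wᴴ) * Uᴴ =
      (U * W) * diagonal (fun i => (d i : ℂ)) * (U * W)ᴴ := by
    rw [conjTranspose_mul]
    simp only [Matrix.mul_assoc]
  rw [this, traceFun_conj_diagonal f]
  rw [conjTranspose_mul, Matrix.mul_assoc, ← Matrix.mul_assoc Uᴴ, hU, Matrix.one_mul, hW]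

theorem traceFun_diagonal (f : ℝ → ℝ) (d : n → ℝ) :
    traceFun f (diagonal fun i => (d i : ℂ)) = ∑ i, f (d i) := by
  simpa using traceFun_conj_diagonal f (W := 1) (by simp) d

/-! ### Ky Fan's principle -/

theorem trace_mul_re_nonneg {n : Type*} [Fintype n] {A B : Matrix n n ℂ}
    (hA : A.PosSemidef) (hB : B.PosSemidef) : 0 ≤ (A * B).trace.re := by
  classical
  open scoped MatrixOrder in
  obtain ⟨C, rfl⟩ := CStarAlgebra.nonneg_iff_eq_star_mul_self.mp hA.nonneg
  rw [star_eq_conjTranspose, Matrix.mul_assoc, trace_mul_comm]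
  exact (Complex.le_def.1 (hB.mul_mul_conjTranspose_same C).trace_nonneg).1

/-- The bound `x` on the sum of the `k` largest eigenvalues of `A`, by Ky Fan's principle. -/
def TopSumLe (A : Matrix n n ℂ) (k : ℕ) (x : ℝ) : Prop :=
  ∀ Q : Matrix n n ℂ, Q.PosSemidef → (1 - Q).PosSemidef → Q.trace.re ≤ k → (Q * A).trace.re ≤ x

/-- One test matrix `Q` serves all summands, which is the subadditivity of Ky Fan sums. -/
theorem TopSumLe.sum {ι : Type*} {s : Finset ι} {A : ι → Matrix n n ℂ} {k : ℕ} {x : ι → ℝ}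
    (h : ∀ i ∈ s, TopSumLe (A i) k (x i)) : TopSumLe (∑ i ∈ s, A i) k (∑ i ∈ s, x i) := by
  intro Q h1 h2 h3
  rw [Matrix.mul_sum, trace_sum, Complex.re_sum]
  exact sum_le_sum fun i hi => h i hi Q h1 h2 h3

/-- The nonzero spectra of `V V*` and `V* V` agree. -/
theorem TopSumLe.mul_conjTranspose {V : Matrix m n ℂ} {k : ℕ} {x : ℝ}
    (h : TopSumLe (Vᴴ * V) k x) : TopSumLe (V * Vᴴ) k x := by
  intro Q h1 h2 h3
  set X := Vᴴ * V with hX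
  have hXp : X.PosSemidef := posSemidef_conjTranspose_mul_self V
  set W : Matrix n n ℂ := hXp.1.eigenvectorUnitary.1
  have hW : Wᴴ * W = 1 := Unitary.coe_star_mul_self hXp.1.eigenvectorUnitary
  have hW' : W * Wᴴ = 1 := mul_eq_one_comm.1 hW
  set d := hXp.1.eigenvalues
  have hd : ∀ i, 0 ≤ d i := hXp.eigenvalues_nonneg
  have hspec : X = W * diagonal (fun i => (d i : ℂ)) * Wᴴ := by
    simpa [W, d, Unitary.conjStarAlgAut_apply, Function.comp_def, star_eq_conjTranspose] using
      hXp.1.spectral_theorem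
  set D : Matrix n n ℂ := diagonal (fun i => (d i : ℂ)) with hD
  -- Because `0⁻¹ = 0`, this is the pseudo-inverse of the square root of `D`, and `P` below is the
  -- support projection of `D`.
  set G : Matrix n n ℂ := diagonal (fun i => (((Real.sqrt (d i))⁻¹ : ℝ) : ℂ)) with hG
  set P : Matrix n n ℂ := diagonal (fun i => if d i = 0 then 0 else 1) with hP
  have hGstar : Gᴴ = G := by
    rw [hG, diagonal_conjTranspose]
    congr 1
    ext i
    simp
  have hGDG : G * D * G = P := by
    rw [hG, hD, hP, diagonal_mul_diagonal, diagonal_mul_diagonal]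
    congr 1
    ext i
    by_cases h0 : d i = 0
    · simp [h0]
    · have h4 : Real.sqrt (d i) ≠ 0 := by
        rw [Real.sqrt_ne_zero (hd i)]
        exact h0
      have h5 : ((Real.sqrt (d i))⁻¹ * d i * (Real.sqrt (d i))⁻¹ : ℝ) = 1 := by
        nth_rewrite 2 [← Real.mul_self_sqrt (hd i)]
        field_simp
      rw [if_neg h0]
      exact_mod_cast h5
  have hDP : D * (1 - P) = 0 := by
    rw [hD, hP, ← diagonal_one, diagonal_sub, diagonal_mul_diagonal, ← diagonal_zero]
    congr 1
    ext i
    by_cases h0 : d i = 0 <;> simp [h0]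
  have hGP : G * P = G := by
    rw [hG, hP, diagonal_mul_diagonal]
    congr 1
    ext i
    by_cases h0 : d i = 0 <;> simp [h0]
  set Y := V * W with hY
  have hYY : Yᴴ * Y = D := by
    calc Yᴴ * Y = Wᴴ * X * W := by
          rw [hY, hX, conjTranspose_mul]; simp only [Matrix.mul_assoc]
      _ = (Wᴴ * W) * D * (Wᴴ * W) := by rw [hspec]; simp only [Matrix.mul_assoc]
      _ = D := by rw [hW, Matrix.one_mul, Matrix.mul_one]
  have hYP : Y * P = Y := by
    have h6 : (Y * (1 - P))ᴴ * (Y * (1 - P)) = 0 := by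
      rw [conjTranspose_mul, Matrix.mul_assoc, ← Matrix.mul_assoc Yᴴ, hYY, hDP, Matrix.mul_zero]
    have h7 := conjTranspose_mul_self_eq_zero.1 h6
    rw [Matrix.mul_sub, Matrix.mul_one, sub_eq_zero] at h7
    exact h7.symm
  -- The partial isometry of a polar decomposition of `V W`: it carries the support of `D` to the
  -- range of `V`, and `V Vᴴ = U D Uᴴ`.
  set U := Y * G with hU
  have hUU : Uᴴ * U = P := by
    rw [hU, conjTranspose_mul, hGstar, Matrix.mul_assoc, ← Matrix.mul_assoc Yᴴ, hYY,
      ← Matrix.mul_assoc, hGDG]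
  have hUP : U * P = U := by rw [hU, Matrix.mul_assoc, hGP]
  have hUDU : U * D * Uᴴ = V * Vᴴ := by
    calc U * D * Uᴴ = Y * (G * D * G) * Yᴴ := by
          rw [hU, conjTranspose_mul, hGstar]; simp only [Matrix.mul_assoc]
      _ = Y * Yᴴ := by rw [hGDG, hYP]
      _ = V * (W * Wᴴ) * Vᴴ := by rw [hY, conjTranspose_mul]; simp only [Matrix.mul_assoc]
      _ = V * Vᴴ := by rw [hW', Matrix.mul_one]
  have hproj : (U * Uᴴ) * (U * Uᴴ) = U * Uᴴ := by
    rw [Matrix.mul_assoc, ← Matrix.mul_assoc Uᴴ, hUU, ← Matrix.mul_assoc, hUP]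
  have hPpos : (1 - P).PosSemidef := by
    rw [hP, ← diagonal_one, diagonal_sub, posSemidef_diagonal_iff]
    intro i
    by_cases h0 : d i = 0 <;> simp [h0]
  have hUUpos : (1 - U * Uᴴ).PosSemidef := by
    have h8 : 1 - U * Uᴴ = (1 - U * Uᴴ)ᴴ * (1 - U * Uᴴ) := by
      have hself : (U * Uᴴ)ᴴ = U * Uᴴ := by rw [conjTranspose_mul, conjTranspose_conjTranspose]
      rw [conjTranspose_sub, conjTranspose_one, hself, Matrix.sub_mul, Matrix.one_mul,
        Matrix.mul_sub, hproj]
      simp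
    rw [h8]
    exact posSemidef_conjTranspose_mul_self _
  -- The test matrix `Q` is pulled back along the partial isometry. One has `0 ≤ R ≤ 1`, the trace
  -- does not grow because `U Uᴴ ≤ 1`, and `R` pairs with `Vᴴ V` as `Q` does with `V Vᴴ`.
  set R := W * (Uᴴ * Q * U) * Wᴴ with hR
  have hR1 : R.PosSemidef := (h1.conjTranspose_mul_mul_same U).mul_mul_conjTranspose_same W
  have hR2 : (1 - R).PosSemidef := by
    have h9 : 1 - R = W * (Uᴴ * (1 - Q) * U + (1 - P)) * Wᴴ := by
      rw [Matrix.mul_sub, Matrix.sub_mul, Matrix.mul_one, hUU, hR]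
      have : P - Uᴴ * Q * U + (1 - P) = 1 - Uᴴ * Q * U := by abel
      rw [this, Matrix.mul_sub, Matrix.sub_mul, Matrix.mul_one, hW']
    rw [h9]
    exact ((h2.conjTranspose_mul_mul_same U).add hPpos).mul_mul_conjTranspose_same W
  have hR3 : R.trace.re ≤ k := by
    have h10 : R.trace = (Q * (U * Uᴴ)).trace := by
      rw [hR, trace_mul_comm, ← Matrix.mul_assoc, hW, Matrix.one_mul, Matrix.mul_assoc,
        trace_mul_comm, Matrix.mul_assoc]
    have h11 := trace_mul_re_nonneg h1 hUUpos
    rw [Matrix.mul_sub, Matrix.mul_one, trace_sub, Complex.sub_re] at h11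
    rw [h10]
    linarith
  have h12 := h R hR1 hR2 hR3
  have h13 : (R * X).trace = (Q * (V * Vᴴ)).trace := by
    calc (R * X).trace = (W * (Uᴴ * Q * U * (Wᴴ * W) * D) * Wᴴ).trace := by
          rw [hR, hspec]; simp only [Matrix.mul_assoc]
      _ = (Wᴴ * W * (Uᴴ * Q * U * (Wᴴ * W) * D)).trace := by
          rw [trace_mul_comm, ← Matrix.mul_assoc, ← Matrix.mul_assoc]
      _ = (Uᴴ * (Q * U * D)).trace := by
          rw [hW, Matrix.one_mul, Matrix.mul_one]; simp only [Matrix.mul_assoc]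
      _ = (Q * (U * D * Uᴴ)).trace := by rw [trace_mul_comm]; simp only [Matrix.mul_assoc]
      _ = (Q * (V * Vᴴ)).trace := by rw [hUDU]
  rwa [← h13]

/-- The sum of the first diagonal entries in a diagonalization is bounded by Ky Fan's principle. -/
theorem TopSumLe.sum_eigenvalues_le {N : ℕ} {W : Matrix (Fin N) (Fin N) ℂ} {d : Fin N → ℝ}
    (hW : Wᴴ * W = 1) {k : ℕ} {x : ℝ}
    (h : TopSumLe (W * diagonal (fun i => (d i : ℂ)) * Wᴴ) k x) :
    ∑ i ∈ univ.filter (fun i : Fin N => (i : ℕ) < k), d i ≤ x := by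
  have hW' : W * Wᴴ = 1 := mul_eq_one_comm.1 hW
  set E : Matrix (Fin N) (Fin N) ℂ := diagonal (fun i => if (i : ℕ) < k then 1 else 0) with hE
  have hE1 : E.PosSemidef := by
    rw [hE, posSemidef_diagonal_iff]
    intro i
    split_ifs <;> simp
  have hE2 : (1 - E).PosSemidef := by
    rw [hE, ← diagonal_one, diagonal_sub, posSemidef_diagonal_iff]
    intro i
    split_ifs <;> simp
  -- The test matrix is the projection onto the first `k` columns of `W`; its rank is smaller than
  -- `k` when `k > N`, so only `≤` is claimed for the trace.
  have h1 := h (W * E * Wᴴ) (hE1.mul_mul_conjTranspose_same W) (by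
      have : 1 - W * E * Wᴴ = W * (1 - E) * Wᴴ := by
        rw [Matrix.mul_sub, Matrix.sub_mul, Matrix.mul_one, hW']
      rw [this]
      exact hE2.mul_mul_conjTranspose_same W) (by
      rw [trace_mul_comm, ← Matrix.mul_assoc, hW, Matrix.one_mul, hE, trace_diagonal]
      rw [← sum_filter, sum_const, nsmul_eq_mul, mul_one, Complex.natCast_re]
      have : (univ.filter fun i : Fin N => (i : ℕ) < k).card ≤ (range k).card := by
        apply card_le_card_of_injOn (fun i : Fin N => (i : ℕ))
        · intro i hi
          simpa using hi
        · exact Fin.val_injective.injOn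
      rw [card_range] at this
      exact_mod_cast this)
  have h2 : (W * E * Wᴴ * (W * diagonal (fun i => (d i : ℂ)) * Wᴴ)).trace =
      ((∑ i ∈ univ.filter (fun i : Fin N => (i : ℕ) < k), d i : ℝ) : ℂ) := by
    have : W * E * Wᴴ * (W * diagonal (fun i => (d i : ℂ)) * Wᴴ) =
        W * (E * (Wᴴ * W) * diagonal (fun i => (d i : ℂ))) * Wᴴ := by
      simp only [Matrix.mul_assoc]
    rw [this, trace_mul_comm, ← Matrix.mul_assoc, hW, Matrix.one_mul, Matrix.mul_one, hE,
      diagonal_mul_diagonal, trace_diagonal, sum_filter, Complex.ofReal_sum]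
    refine sum_congr rfl fun i _ => ?_
    split_ifs <;> simp
  rw [h2, Complex.ofReal_re] at h1
  exact h1

/-- The decreasing eigenvalues of `A` are majorized by `y`, and Karamata's inequality applies. It
needs only the eigenvalues sorted, so `y` may come in any order whose partial sums dominate. -/
theorem IsDensity.traceFun_ge {N : ℕ} {A : Matrix (Fin N) (Fin N) ℂ} (hA : IsDensity A)
    {f : ℝ → ℝ} (hf : ConcaveOn ℝ (Set.Icc 0 1) f) {y : ℕ → ℝ}
    (hy : ∀ i < N, y i ∈ Set.Icc (0 : ℝ) 1) (hsum : ∑ i ∈ range N, y i = 1)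
    (h : ∀ k, 1 ≤ k → k ≤ N → TopSumLe A k (∑ i ∈ range k, y i)) :
    ∑ i ∈ range N, f (y i) ≤ traceFun f A := by
  obtain ⟨W, d, hW, -, hd, hAd⟩ := exists_sorted_diagonalization hA.1.1
  have htr : ∑ i, d i = 1 := by
    have h1 := hA.2
    rw [hAd, trace_mul_comm, ← Matrix.mul_assoc, hW, Matrix.one_mul, trace_diagonal] at h1
    exact_mod_cast h1
  have hpos : ∀ i, 0 ≤ d i := by
    have h1 := hA.1.conjTranspose_mul_mul_same W
    have h2 : Wᴴ * A * W = diagonal (fun i => (d i : ℂ)) := by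
      calc Wᴴ * A * W = (Wᴴ * W) * diagonal (fun i => (d i : ℂ)) * (Wᴴ * W) := by
            rw [hAd]; simp only [Matrix.mul_assoc]
        _ = _ := by rw [hW, Matrix.one_mul, Matrix.mul_one]
    rw [h2, posSemidef_diagonal_iff] at h1
    intro i
    exact_mod_cast h1 i
  have hle : ∀ i, d i ≤ 1 := fun i =>
    htr ▸ single_le_sum (f := d) (fun j _ => hpos j) (mem_univ i)
  set x : ℕ → ℝ := fun i => if hi : i < N then d ⟨i, hi⟩ else 0 with hx
  have hxd : ∀ i : Fin N, x i = d i := fun i => by simp [hx]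
  have hrange : ∀ g : ℝ → ℝ, ∑ i ∈ range N, g (x i) = ∑ i, g (d i) := by
    intro g
    rw [← Fin.sum_univ_eq_sum_range (fun i => g (x i))]
    exact sum_congr rfl fun i _ => by rw [hxd]
  have hpart : ∀ k ≤ N, ∑ i ∈ range k, x i =
      ∑ i ∈ univ.filter (fun i : Fin N => (i : ℕ) < k), d i := by
    intro k hk
    have h1 : range k = (range N).filter (fun i => i < k) := by
      ext i
      simp only [mem_range, mem_filter]
      omega
    rw [h1, sum_filter, sum_filter, ← Fin.sum_univ_eq_sum_range (fun i => if i < k then x i else 0)]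
    exact sum_congr rfl fun i _ => by rw [hxd]
  rw [hAd, traceFun_conj_diagonal f hW, ← hrange]
  apply karamata hf _ hy _ _ ((hrange id).trans htr |>.trans hsum.symm)
  · intro i hi
    simp only [hx, dif_pos hi]
    exact ⟨hpos _, hle _⟩
  · intro i j hij hj
    simp only [hx, dif_pos hj, dif_pos (lt_of_le_of_lt hij hj)]
    exact hd hij
  · intro k hk
    rcases Nat.eq_zero_or_pos k with rfl | hk0
    · simp
    change ∑ i ∈ range k, x i ≤ _
    rw [hpart k hk]
    apply TopSumLe.sum_eigenvalues_le hW
    rw [← hAd]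
    exact h k hk0 hk

end

section

open Finset Matrix Real

/-! ### Binomial identities -/

theorem sum_choose_mul_choose_sub (p q k : ℕ) :
    ∑ r ∈ range (k + 1), p.choose r * q.choose (k - r) = (p + q).choose k := by
  rw [Nat.add_choose_eq, Nat.sum_antidiagonal_eq_sum_range_succ fun i j => p.choose i * q.choose j]

/-- Compare coefficients in the product of the powers `p + 1` and `q + 1` of the geometric series.
-/
theorem sum_multichoose_convolution (p q k : ℕ) :
    ∑ u ∈ range (k + 1), (p + u).choose u * (q + (k - u)).choose (k - u) =
      (p + q + 1 + k).choose k := by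
  have h1 := PowerSeries.mk_one_pow_eq_mk_choose_add ℤ p
  have h2 := PowerSeries.mk_one_pow_eq_mk_choose_add ℤ q
  have h3 := PowerSeries.mk_one_pow_eq_mk_choose_add ℤ (p + q + 1)
  have h4 : p + q + 1 + 1 = (p + 1) + (q + 1) := by ring
  rw [h4, pow_add, h1, h2] at h3
  have h5 := congrArg (PowerSeries.coeff k) h3
  rw [PowerSeries.coeff_mul, Nat.sum_antidiagonal_eq_sum_range_succ_mk] at h5
  simp only [PowerSeries.coeff_mk] at h5
  rw [Nat.choose_symm_add] at h5
  rw [← h4] at *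
  have h6 : ∀ u, (p + u).choose p = (p + u).choose u := fun u => Nat.choose_symm_add
  have h7 : ∀ u, (q + u).choose q = (q + u).choose u := fun u => Nat.choose_symm_add
  simp only [h6, h7] at h5
  exact_mod_cast h5

theorem choose_mul_choose_sub_comm (n s t : ℕ) :
    n.choose s * (n - s).choose t = n.choose t * (n - t).choose s := by
  have h1 := Nat.choose_mul (n := n) (k := s + t) (s := s) (by omega)
  have h2 := Nat.choose_mul (n := n) (k := s + t) (s := t) (by omega)
  rw [Nat.add_sub_cancel_left] at h1
  rw [Nat.add_sub_cancel] at h2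
  rw [← h1, ← h2, Nat.choose_symm_add]

theorem choose_mul_choose_swap {x y m m' r : ℕ} (h : x + m = y + m') (hr : r ≤ m) (hr' : r ≤ m') :
    (x + m).choose m' * (m'.choose r * y.choose (m - r)) =
      (x + m).choose m * (m.choose r * x.choose (m' - r)) := by
  rw [← mul_assoc, ← mul_assoc, Nat.choose_mul hr, Nat.choose_mul hr', mul_assoc, mul_assoc]
  have hy : y = x + m - r - (m' - r) := by omega
  have hx : x = x + m - r - (m - r) := by omega
  have := choose_mul_choose_sub_comm (x + m - r) (m' - r) (m - r)
  rw [← hx, ← hy] at this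
  rw [this]

/-- The two radicands have a ratio independent of `r` (`choose_mul_choose_swap`), so each product of
roots is a constant times a binomial product and Vandermonde's identity sums them. This is normal
ordering in a single mode. -/
theorem sum_sqrt_choose {x y m m' : ℕ} (h : x + m = y + m') :
    ∑ r ∈ range (m + 1), √(m.choose r * y.choose (m - r) : ℝ) *
      √(m'.choose r * x.choose (m' - r) : ℝ) =
      √((x + m).choose m : ℝ) * √((x + m).choose m' : ℝ) := by
  have hpos : (0 : ℝ) < (x + m).choose m' := by
    exact_mod_cast Nat.choose_pos (by omega)
  have hterm : ∀ r ∈ range (m + 1), √((x + m).choose m' : ℝ) *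
      (√(m.choose r * y.choose (m - r) : ℝ) * √(m'.choose r * x.choose (m' - r) : ℝ)) =
      √((x + m).choose m : ℝ) *
        if r ≤ m' then (m.choose r * x.choose (m' - r) : ℝ) else 0 := by
    intro r hr
    rw [mem_range, Nat.lt_succ_iff] at hr
    split_ifs with hr'
    · have h1 : ((x + m).choose m' * (m'.choose r * y.choose (m - r)) : ℝ) =
          (x + m).choose m * (m.choose r * x.choose (m' - r)) := by
        exact_mod_cast choose_mul_choose_swap h hr hr'
      rw [← Real.sqrt_mul (by positivity), ← Real.sqrt_mul (by positivity)]
      have h2 : ((x + m).choose m' : ℝ) *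
          ((m.choose r * y.choose (m - r)) * (m'.choose r * x.choose (m' - r))) =
          (x + m).choose m * (m.choose r * x.choose (m' - r)) ^ 2 := by
        linear_combination (m.choose r * x.choose (m' - r) : ℝ) * h1
      rw [h2, Real.sqrt_mul (by positivity), Real.sqrt_sq (by positivity)]
    · rw [Nat.choose_eq_zero_of_lt (show m' < r by omega)]
      simp
  have hsum : ∑ r ∈ range (m + 1), (if r ≤ m' then (m.choose r * x.choose (m' - r) : ℝ) else 0) =
      (x + m).choose m' := by
    have h1 : ((x + m).choose m' : ℝ) =
        ∑ r ∈ range (m' + 1), (m.choose r * x.choose (m' - r) : ℝ) := by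
      rw [add_comm x m]
      exact_mod_cast (sum_choose_mul_choose_sub m x m').symm
    rw [h1, ← sum_filter]
    apply sum_subset
    · intro r hr
      simp only [mem_filter, mem_range] at hr ⊢
      omega
    · intro r hr hr'
      simp only [mem_filter, mem_range] at hr hr'
      rw [Nat.choose_eq_zero_of_lt (show m < r by omega)]
      simp
  have h2 : √((x + m).choose m' : ℝ) ≠ 0 := (Real.sqrt_pos.2 hpos).ne'
  apply mul_left_cancel₀ h2
  rw [mul_sum, sum_congr rfl hterm, ← mul_sum, hsum]
  nth_rewrite 1 [← Real.mul_self_sqrt hpos.le]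
  ring

/-! ### The Kraus operators -/

/-- The matrix entries of the Kraus operators of the channel adding `k` bosons up to a total of `b`. -/
def krausCoeff (b k m p i : ℕ) : ℝ :=
  if p = i + m then √(p.choose m * (b - p).choose (k - m) : ℝ) else 0

/-- Normal ordering: a product of an annihilation and a creation operator of degree `k` is a sum of
products of creation and annihilation operators of lower degree. -/
theorem sum_krausCoeff_mul {a k m m' x y : ℕ} (hm : m ≤ k) (hm' : m' ≤ k) (hx : x ≤ a)
    (hy : y ≤ a) :
    ∑ p ∈ range (a + k + 1), krausCoeff (a + k) k m p x * krausCoeff (a + k) k m' p y =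
      ∑ l ∈ range (min a k + 1), ∑ r ∈ range (k - l + 1), ∑ i ∈ range (a - l + 1),
        (∑ j ∈ range (l + 1), krausCoeff k (k - l) r m j * krausCoeff a (a - l) i y j) *
        (∑ j ∈ range (l + 1), krausCoeff k (k - l) r m' j * krausCoeff a (a - l) i x j) := by
  -- The first Kraus coefficient forces `j = m - r`, so the inner sum has at most one nonzero term.
  -- Its two factors collect the binomials of the two modes.
  have hinner : ∀ m ≤ k, ∀ y ≤ a, ∀ l ∈ range (min a k + 1), ∀ r ∈ range (k - l + 1),
      ∀ i ∈ range (a - l + 1),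
      ∑ j ∈ range (l + 1), krausCoeff k (k - l) r m j * krausCoeff a (a - l) i y j =
        if r ≤ m ∧ y + r = m + i ∧ m ≤ l + r then
          √(m.choose r * y.choose (m - r) : ℝ) *
          √((k - m).choose (k - l - r) * (a - y).choose (l + r - m) : ℝ) else 0 := by
    intro m hm y hy l hl r hr i hi
    simp only [mem_range] at hl hr hi
    split_ifs with hc
    · obtain ⟨h1, h2, h3⟩ := hc
      rw [sum_eq_single (m - r)]
      · rw [krausCoeff, krausCoeff, if_pos (by omega), if_pos (by omega)]
        have e1 : y.choose i = y.choose (m - r) := Nat.choose_symm_of_eq_add (by omega)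
        have e2 : (a - y).choose (a - l - i) = (a - y).choose (l + r - m) := by
          by_cases hle : l + r - m ≤ a - y
          · exact Nat.choose_symm_of_eq_add (by omega)
          · omega
        rw [e1, e2, ← Real.sqrt_mul (by positivity), ← Real.sqrt_mul (by positivity)]
        congr 1
        ring
      · intro j _ hj
        rw [krausCoeff, if_neg (by omega), zero_mul]
      · intro hj
        simp only [mem_range] at hj
        omega
    · apply sum_eq_zero
      intro j hj
      simp only [mem_range] at hj
      by_cases h1 : m = j + r
      · by_cases h2 : y = j + i
        · omega
        · rw [krausCoeff, krausCoeff, if_neg h2, mul_zero]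
      · rw [krausCoeff, if_neg h1, zero_mul]
  have hR : ∑ l ∈ range (min a k + 1), ∑ r ∈ range (k - l + 1), ∑ i ∈ range (a - l + 1),
        (∑ j ∈ range (l + 1), krausCoeff k (k - l) r m j * krausCoeff a (a - l) i y j) *
        (∑ j ∈ range (l + 1), krausCoeff k (k - l) r m' j * krausCoeff a (a - l) i x j) =
      ∑ l ∈ range (min a k + 1), ∑ r ∈ range (k - l + 1), ∑ i ∈ range (a - l + 1),
        (if r ≤ m ∧ y + r = m + i ∧ m ≤ l + r then
          √(m.choose r * y.choose (m - r) : ℝ) *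
          √((k - m).choose (k - l - r) * (a - y).choose (l + r - m) : ℝ) else 0) *
        (if r ≤ m' ∧ x + r = m' + i ∧ m' ≤ l + r then
          √(m'.choose r * x.choose (m' - r) : ℝ) *
          √((k - m').choose (k - l - r) * (a - x).choose (l + r - m') : ℝ) else 0) :=
    sum_congr rfl fun l hl => sum_congr rfl fun r hr => sum_congr rfl fun i hi => by
      rw [hinner m hm y hy l hl r hr i hi, hinner m' hm' x hx l hl r hr i hi]
  rw [hR]
  -- Conservation of bosons in the second mode: otherwise both sides vanish term by term.
  by_cases h : x + m = y + m'
  · have hL : ∑ p ∈ range (a + k + 1), krausCoeff (a + k) k m p x * krausCoeff (a + k) k m' p y =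
        (√((x + m).choose m : ℝ) * √((x + m).choose m' : ℝ)) *
        (√((a - x + (k - m)).choose (k - m) : ℝ) * √((a - x + (k - m)).choose (k - m') : ℝ)) := by
      rw [sum_eq_single (x + m)]
      · rw [krausCoeff, krausCoeff, if_pos rfl, if_pos h]
        have e : a + k - (x + m) = a - x + (k - m) := by omega
        rw [e, Real.sqrt_mul (by positivity), Real.sqrt_mul (by positivity)]
        ring
      · intro p _ hp
        rw [krausCoeff, if_neg hp, zero_mul]
      · intro hp
        simp only [mem_range] at hp
        omega
    rw [hL, ← sum_sqrt_choose h,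
      ← sum_sqrt_choose (show a - x + (k - m) = a - y + (k - m') by omega), sum_mul_sum]
    simp only [sum_sigma']
    have hne : ∀ {u v : ℕ} {c : ℝ}, √(u.choose v * c : ℝ) ≠ 0 → v ≤ u := by
      intro u v c hc
      by_contra hlt
      rw [Nat.choose_eq_zero_of_lt (by omega)] at hc
      simp at hc
    have hne' : ∀ {u v : ℕ} {c : ℝ}, √(c * u.choose v : ℝ) ≠ 0 → v ≤ u := by
      intro u v c hc
      rw [mul_comm] at hc
      exact hne hc
    -- Here `z = (r, t)` counts the creation operators left uncontracted in the second and in the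
    -- first mode, so `l = k - r - t` have been contracted. The index sets match only on nonzero
    -- terms, whose nonvanishing binomials supply the required inequalities.
    refine sum_bij_ne_zero (fun z _ _ => ⟨k - z.1 - z.2, z.1, y + z.1 - m⟩) ?_ ?_ ?_ ?_
    · rintro ⟨r, t⟩ h1 h2
      simp only [mem_sigma, mem_range, mul_ne_zero_iff] at h1 h2 ⊢
      have := hne h2.1.1
      have := hne' h2.1.1
      have := hne h2.1.2
      have := hne' h2.1.2
      have := hne h2.2.1
      have := hne' h2.2.1
      have := hne h2.2.2
      have := hne' h2.2.2
      omega
    · rintro ⟨r, t⟩ h1 h2 ⟨r', t'⟩ h1' h2' heq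
      simp only [mem_sigma, mem_range, mul_ne_zero_iff] at h1 h2 h1' h2'
      simp only [Sigma.mk.injEq, heq_eq_eq] at heq ⊢
      omega
    · rintro ⟨l, r, i⟩ h1 h2
      simp only [mem_sigma, mem_range, mul_ne_zero_iff] at h1 h2
      obtain ⟨h2, h2'⟩ := h2
      split_ifs at h2 h2' with hc hc'
      all_goals first | exact absurd rfl h2 | exact absurd rfl h2' | skip
      refine ⟨⟨r, k - l - r⟩, ?_, ?_, ?_⟩
      · simp only [mem_sigma, mem_range]
        omega
      · have e1 : k - m - (k - l - r) = l + r - m := by omega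
        have e2 : k - m' - (k - l - r) = l + r - m' := by omega
        simp only [e1, e2]
        rw [mul_ne_zero_iff] at h2 h2'
        exact mul_ne_zero (mul_ne_zero h2.1 h2'.1) (mul_ne_zero h2.2 h2'.2)
      · simp only [Sigma.mk.injEq, heq_eq_eq, true_and]
        omega
    · rintro ⟨r, t⟩ h1 h2
      simp only [mem_sigma, mem_range, mul_ne_zero_iff] at h1 h2
      have := hne h2.1.1
      have := hne' h2.1.1
      have := hne h2.1.2
      have := hne' h2.1.2
      have := hne h2.2.1
      have := hne' h2.2.1
      have := hne h2.2.2
      have := hne' h2.2.2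
      dsimp only at *
      rw [if_pos (by omega), if_pos (by omega)]
      have e1 : k - (k - r - t) - r = t := by omega
      have e2 : k - r - t + r - m = k - m - t := by omega
      have e3 : k - r - t + r - m' = k - m' - t := by omega
      rw [e1, e2, e3]
      ring
  · rw [sum_eq_zero, eq_comm]
    · refine sum_eq_zero fun l _ => sum_eq_zero fun r _ => sum_eq_zero fun i _ => ?_
      split_ifs <;> first | omega | simp
    · intro p _
      by_cases h1 : p = x + m
      · rw [krausCoeff, krausCoeff, if_neg (show ¬ p = y + m' by omega), mul_zero]
      · rw [krausCoeff, if_neg h1, zero_mul]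

end

/-! ### The channels adding and removing bosons, and the Gram matrix of a pure state. -/

section

open Finset Matrix Real

/-- The Kraus operators of the channel from spin `a/2` to spin `b/2`, for `a ≤ b`: up to a factor,
the products of `m` creation operators of the second mode and `b - a - m` of the first. -/
def krausOp (a b m : ℕ) : Matrix (Fin (b + 1)) (Fin (a + 1)) ℂ :=
  Matrix.of fun p i => (krausCoeff b (b - a) m p i : ℂ)

/-- The unnormalized channel adding `b - a` bosons. -/
def amplify (a b : ℕ) (ρ : Matrix (Fin (a + 1)) (Fin (a + 1)) ℂ) :
    Matrix (Fin (b + 1)) (Fin (b + 1)) ℂ :=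
  ∑ m ∈ range (b - a + 1), krausOp a b m * ρ * (krausOp a b m)ᴴ

/-- The unnormalized channel removing `b - a` bosons. -/
def reduce (a b : ℕ) (ρ : Matrix (Fin (b + 1)) (Fin (b + 1)) ℂ) :
    Matrix (Fin (a + 1)) (Fin (a + 1)) ℂ :=
  ∑ m ∈ range (b - a + 1), (krausOp a b m)ᴴ * ρ * krausOp a b m

theorem krausOp_apply (a b m : ℕ) (p : Fin (b + 1)) (i : Fin (a + 1)) :
    krausOp a b m p i = (krausCoeff b (b - a) m p i : ℂ) := rfl

theorem star_krausOp_apply (a b m : ℕ) (p : Fin (b + 1)) (i : Fin (a + 1)) :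
    (krausOp a b m)ᴴ i p = (krausCoeff b (b - a) m p i : ℂ) := by
  simp [conjTranspose_apply, krausOp_apply]

theorem posSemidef_amplify {a b : ℕ} {ρ : Matrix (Fin (a + 1)) (Fin (a + 1)) ℂ}
    (h : ρ.PosSemidef) : (amplify a b ρ).PosSemidef :=
  posSemidef_sum _ fun _ _ => h.mul_mul_conjTranspose_same _

theorem posSemidef_reduce {a b : ℕ} {ρ : Matrix (Fin (b + 1)) (Fin (b + 1)) ℂ}
    (h : ρ.PosSemidef) : (reduce a b ρ).PosSemidef :=
  posSemidef_sum _ fun _ _ => h.conjTranspose_mul_mul_same _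

theorem amplify_sum {ι : Type*} (s : Finset ι) (a b : ℕ)
    (ρ : ι → Matrix (Fin (a + 1)) (Fin (a + 1)) ℂ) :
    amplify a b (∑ i ∈ s, ρ i) = ∑ i ∈ s, amplify a b (ρ i) := by
  simp only [amplify, Matrix.mul_sum, Matrix.sum_mul]
  exact sum_comm

theorem krausCoeff_mul_krausCoeff_of_ne {b k m p i j : ℕ} (h : i ≠ j) :
    krausCoeff b k m p i * krausCoeff b k m p j = 0 := by
  by_cases hp : p = i + m
  · rw [krausCoeff, krausCoeff, if_neg (show ¬ p = j + m by omega), mul_zero]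
  · rw [krausCoeff, if_neg hp, zero_mul]

/-- Each Kraus operator shifts the index by `m`, so the sum is diagonal; the convolution identity
makes the diagonal entries independent of `i`. This fixes the trace normalization of `amplify`. -/
theorem sum_conjTranspose_mul_krausOp {a b : ℕ} (hab : a ≤ b) :
    ∑ m ∈ range (b - a + 1), (krausOp a b m)ᴴ * krausOp a b m =
      ((b + 1).choose (b - a) : ℂ) • (1 : Matrix (Fin (a + 1)) (Fin (a + 1)) ℂ) := by
  ext i j
  simp only [Matrix.sum_apply, Matrix.mul_apply, star_krausOp_apply, krausOp_apply,
    Matrix.smul_apply, Matrix.one_apply, ← Complex.ofReal_mul, ← Complex.ofReal_sum]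
  split_ifs with hij
  · subst hij
    have h1 : ∀ m ∈ range (b - a + 1), ∑ p : Fin (b + 1),
        krausCoeff b (b - a) m p i * krausCoeff b (b - a) m p i =
        (((i : ℕ) + m).choose m * ((a - (i : ℕ)) + (b - a - m)).choose (b - a - m) : ℝ) := by
      intro m hm
      rw [mem_range] at hm
      have hi := i.2
      rw [Fin.sum_univ_eq_sum_range (fun p => krausCoeff b (b - a) m p i *
        krausCoeff b (b - a) m p i), sum_eq_single ((i : ℕ) + m)]
      · rw [krausCoeff, if_pos rfl, Real.mul_self_sqrt (by positivity)]
        congr 3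
        omega
      · intro p _ hp
        rw [krausCoeff, if_neg hp, zero_mul]
      · intro hp
        simp only [mem_range] at hp
        omega
    rw [sum_congr rfl h1]
    have h2 := sum_multichoose_convolution i (a - i) (b - a)
    have hi := i.2
    have h3 : (i : ℕ) + (a - i) + 1 + (b - a) = b + 1 := by omega
    rw [h3] at h2
    rw [← h2]
    push_cast
    simp
  · have h1 : ∀ m ∈ range (b - a + 1), ∑ p : Fin (b + 1),
        krausCoeff b (b - a) m p i * krausCoeff b (b - a) m p j = 0 := fun m _ =>
      sum_eq_zero fun p _ => krausCoeff_mul_krausCoeff_of_ne (fun h => hij (Fin.ext h))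
    rw [sum_congr rfl h1]
    simp

/-- Here the diagonal entries are constant by Vandermonde's identity for `p + (b - p) = b`. This
fixes the trace normalization of `reduce`. -/
theorem sum_krausOp_mul_conjTranspose {a b : ℕ} (hab : a ≤ b) :
    ∑ m ∈ range (b - a + 1), krausOp a b m * (krausOp a b m)ᴴ =
      (b.choose a : ℂ) • (1 : Matrix (Fin (b + 1)) (Fin (b + 1)) ℂ) := by
  ext p q
  simp only [Matrix.sum_apply, Matrix.mul_apply, star_krausOp_apply, krausOp_apply,
    Matrix.smul_apply, Matrix.one_apply, ← Complex.ofReal_mul, ← Complex.ofReal_sum]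
  split_ifs with hpq
  · subst hpq
    have hp := p.2
    have h1 : ∀ m ∈ range (b - a + 1), ∑ i : Fin (a + 1),
        krausCoeff b (b - a) m p i * krausCoeff b (b - a) m p i =
        ((p : ℕ).choose m * (b - p).choose (b - a - m) : ℝ) := by
      intro m hm
      rw [mem_range] at hm
      rw [Fin.sum_univ_eq_sum_range (fun i => krausCoeff b (b - a) m p i *
        krausCoeff b (b - a) m p i)]
      by_cases hm2 : m ≤ p
      · by_cases hm3 : (p : ℕ) - m ≤ a
        · rw [sum_eq_single ((p : ℕ) - m)]
          · rw [krausCoeff, if_pos (by omega), Real.mul_self_sqrt (by positivity)]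
          · intro i _ hi
            rw [krausCoeff, if_neg (by omega), zero_mul]
          · intro hi
            simp only [mem_range] at hi
            omega
        · rw [Nat.choose_eq_zero_of_lt (show b - p < b - a - m by omega)]
          rw [sum_eq_zero]
          · simp
          · intro i hi
            rw [mem_range] at hi
            rw [krausCoeff, if_neg (by omega), zero_mul]
      · rw [Nat.choose_eq_zero_of_lt (show (p : ℕ) < m by omega), sum_eq_zero]
        · simp
        · intro i _
          rw [krausCoeff, if_neg (by omega), zero_mul]
    rw [sum_congr rfl h1]
    have h2 := sum_choose_mul_choose_sub p (b - p) (b - a)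
    have h3 : (p : ℕ) + (b - p) = b := by omega
    rw [h3, Nat.choose_symm hab] at h2
    rw [← h2]
    push_cast
    simp
  · have h1 : ∀ m ∈ range (b - a + 1), ∑ i : Fin (a + 1),
        krausCoeff b (b - a) m p i * krausCoeff b (b - a) m q i = 0 := fun m _ =>
      sum_eq_zero fun i _ => by
        by_cases h : (p : ℕ) = i + m
        · rw [krausCoeff, krausCoeff, if_neg (show ¬ (q : ℕ) = i + m from
            fun h' => hpq (Fin.ext (h.trans h'.symm))), mul_zero]
        · rw [krausCoeff, if_neg h, zero_mul]
    rw [sum_congr rfl h1]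
    simp

theorem trace_amplify {a b : ℕ} (hab : a ≤ b) (ρ : Matrix (Fin (a + 1)) (Fin (a + 1)) ℂ) :
    (amplify a b ρ).trace = (b + 1).choose (b - a) * ρ.trace := by
  have h : ∀ m, (krausOp a b m * ρ * (krausOp a b m)ᴴ).trace =
      ((krausOp a b m)ᴴ * krausOp a b m * ρ).trace := fun m => by
    rw [trace_mul_comm, Matrix.mul_assoc]
  rw [amplify, trace_sum, sum_congr rfl fun m _ => h m, ← trace_sum, ← Matrix.sum_mul,
    sum_conjTranspose_mul_krausOp hab]
  simp

theorem trace_reduce {a b : ℕ} (hab : a ≤ b) (ρ : Matrix (Fin (b + 1)) (Fin (b + 1)) ℂ) :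
    (reduce a b ρ).trace = b.choose a * ρ.trace := by
  have h : ∀ m, ((krausOp a b m)ᴴ * ρ * krausOp a b m).trace =
      (krausOp a b m * (krausOp a b m)ᴴ * ρ).trace := fun m => by
    rw [trace_mul_comm, Matrix.mul_assoc]
  rw [reduce, trace_sum, sum_congr rfl fun m _ => h m, ← trace_sum, ← Matrix.sum_mul,
    sum_krausOp_mul_conjTranspose hab]
  simp

/-- The matrix with columns `krausOp a b m v`. -/
def krausCols (a b k : ℕ) (v : Fin (a + 1) → ℂ) : Matrix (Fin (b + 1)) (Fin (k + 1)) ℂ :=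
  Matrix.of fun p m => (krausOp a b m *ᵥ v) p

theorem krausCols_mul_conjTranspose {a b k : ℕ} (hk : a + k = b) (v : Fin (a + 1) → ℂ) :
    krausCols a b k v * (krausCols a b k v)ᴴ = amplify a b (vecMulVec v (star v)) := by
  have hk' : b - a = k := by omega
  ext p q
  rw [amplify, hk', Matrix.sum_apply, Matrix.mul_apply, ← Fin.sum_univ_eq_sum_range
    (fun m => (krausOp a b m * vecMulVec v (star v) * (krausOp a b m)ᴴ) p q)]
  refine sum_congr rfl fun m _ => ?_
  rw [mul_vecMulVec, vecMulVec_mul, vecMulVec_apply, ← star_mulVec]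
  rfl

theorem amplify_reduce_vecMulVec (l a b : ℕ) (v : Fin (a + 1) → ℂ) :
    amplify l b (reduce l a (vecMulVec v (star v))) =
      ∑ r ∈ range (b - l + 1), ∑ i ∈ range (a - l + 1),
        vecMulVec ((krausOp l b r * (krausOp l a i)ᴴ) *ᵥ v)
          (star ((krausOp l b r * (krausOp l a i)ᴴ) *ᵥ v)) := by
  rw [amplify, reduce]
  refine sum_congr rfl fun r _ => ?_
  rw [Matrix.mul_sum, Matrix.sum_mul]
  refine sum_congr rfl fun i _ => ?_
  rw [mul_vecMulVec, vecMulVec_mul, mul_vecMulVec, vecMulVec_mul, star_mulVec, mulVec_mulVec,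
    vecMul_vecMul, conjTranspose_mul, conjTranspose_conjTranspose]

theorem krausOp_mul_conjTranspose_apply (l a b r i : ℕ) (m : Fin (b + 1)) (y : Fin (a + 1)) :
    (krausOp l b r * (krausOp l a i)ᴴ) m y = ((∑ j ∈ range (l + 1),
      krausCoeff b (b - l) r m j * krausCoeff a (a - l) i y j : ℝ) : ℂ) := by
  rw [Matrix.mul_apply, ← Fin.sum_univ_eq_sum_range
    (fun j => krausCoeff b (b - l) r m j * krausCoeff a (a - l) i y j), Complex.ofReal_sum]
  refine sum_congr rfl fun j _ => ?_
  rw [star_krausOp_apply, krausOp_apply, Complex.ofReal_mul]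

theorem sum_mul_sum_comm {ι κ : Type*} [Fintype κ] (s : Finset ι) (g h : ι → κ → ℝ) (v : κ → ℂ) :
    ∑ t ∈ s, (∑ y, (g t y : ℂ) * v y) * ∑ x, (h t x : ℂ) * (starRingEnd ℂ) (v x) =
      ∑ x, ∑ y, (starRingEnd ℂ) (v x) * v y * ((∑ t ∈ s, g t y * h t x : ℝ) : ℂ) := by
  have h1 : ∀ t, (∑ y, (g t y : ℂ) * v y) * ∑ x, (h t x : ℂ) * (starRingEnd ℂ) (v x) =
      ∑ x, ∑ y, (starRingEnd ℂ) (v x) * v y * ((g t y * h t x : ℝ) : ℂ) := by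
    intro t
    rw [mul_comm, sum_mul_sum]
    refine sum_congr rfl fun x _ => sum_congr rfl fun y _ => ?_
    push_cast
    ring
  rw [sum_congr rfl fun t _ => h1 t, sum_comm]
  refine sum_congr rfl fun x _ => ?_
  rw [sum_comm]
  refine sum_congr rfl fun y _ => ?_
  rw [← mul_sum, ← Complex.ofReal_sum]

/-- The Gram matrix of the vectors `krausOp a b m v` in terms of reduced density matrices. -/
theorem conjTranspose_mul_krausCols {a b k : ℕ} (hk : a + k = b) (v : Fin (a + 1) → ℂ) :
    (krausCols a b k v)ᴴ * krausCols a b k v =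
      ∑ l ∈ range (min a k + 1), amplify l k (reduce l a (vecMulVec v (star v))) := by
  subst hk
  ext m m'
  -- Both sides are sesquilinear in `v`; they are brought to a common form so that only the
  -- coefficients of `star (v x) * v y` remain to be compared.
  have hL : ((krausCols a (a + k) k v)ᴴ * krausCols a (a + k) k v) m m' =
      ∑ x, ∑ y, star (v x) * v y * ((∑ p ∈ range (a + k + 1),
        krausCoeff (a + k) k m p x * krausCoeff (a + k) k m' p y : ℝ) : ℂ) := by
    rw [Matrix.mul_apply]
    have h1 : ∀ p, (krausCols a (a + k) k v)ᴴ m p * krausCols a (a + k) k v p m' =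
        ∑ x, ∑ y, star (v x) * v y *
          ((krausCoeff (a + k) k m p x * krausCoeff (a + k) k m' p y : ℝ) : ℂ) := by
      intro p
      simp only [krausCols, conjTranspose_apply, of_apply, mulVec, dotProduct, krausOp_apply,
        star_sum, star_mul', Nat.add_sub_cancel_left]
      rw [sum_mul_sum]
      refine sum_congr rfl fun x _ => sum_congr rfl fun y _ => ?_
      rw [Complex.star_def, Complex.conj_ofReal]
      push_cast
      ring
    rw [sum_congr rfl fun p _ => h1 p, sum_comm]
    refine sum_congr rfl fun x _ => ?_
    rw [sum_comm]
    refine sum_congr rfl fun y _ => ?_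
    rw [← mul_sum, ← Complex.ofReal_sum, Fin.sum_univ_eq_sum_range (fun p =>
      krausCoeff (a + k) k m p x * krausCoeff (a + k) k m' p y)]
  have hR : (∑ l ∈ range (min a k + 1),
      amplify l k (reduce l a (vecMulVec v (star v)))) m m' =
      ∑ x, ∑ y, star (v x) * v y * ((∑ l ∈ range (min a k + 1), ∑ r ∈ range (k - l + 1),
        ∑ i ∈ range (a - l + 1),
        (∑ j ∈ range (l + 1), krausCoeff k (k - l) r m j * krausCoeff a (a - l) i y j) *
        (∑ j ∈ range (l + 1), krausCoeff k (k - l) r m' j * krausCoeff a (a - l) i x j) : ℝ) :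
          ℂ) := by
    simp only [amplify_reduce_vecMulVec, Matrix.sum_apply, vecMulVec_apply, mulVec, dotProduct,
      krausOp_mul_conjTranspose_apply, Pi.star_apply, star_sum, star_mul', Complex.star_def,
      Complex.conj_ofReal]
    simp only [sum_sigma' (range _)]
    exact sum_mul_sum_comm _ _ _ v
  rw [hL, hR]
  refine sum_congr rfl fun x _ => sum_congr rfl fun y _ => ?_
  rw [sum_krausCoeff_mul (Nat.lt_succ_iff.1 m.2) (Nat.lt_succ_iff.1 m'.2)
    (Nat.lt_succ_iff.1 x.2) (Nat.lt_succ_iff.1 y.2)]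

/-! ### Majorization of all amplified states by the coherent one. -/

/-- The spectrum of the image of a coherent state, in decreasing order. -/
def coherentWeight (a b i : ℕ) : ℝ := if i + a ≤ b then ((b - i).choose a : ℝ) else 0

theorem coherentWeight_nonneg (a b i : ℕ) : 0 ≤ coherentWeight a b i := by
  rw [coherentWeight]
  split_ifs <;> positivity

/-- Vandermonde's identity for `b - i = a + (k - i)`. It closes the induction without loss: the
bounds for the reductions, weighted by their traces `a.choose l`, reproduce the coherent spectrum.
-/
theorem sum_choose_mul_coherentWeight {a b k : ℕ} (hk : a + k = b) (i : ℕ) :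
    ∑ l ∈ range (min a k + 1), (a.choose l : ℝ) * coherentWeight l k i = coherentWeight a b i := by
  by_cases hi : i ≤ k
  · have h1 := sum_choose_mul_choose_sub a (k - i) a
    have h2 : a + (k - i) = b - i := by omega
    rw [h2] at h1
    rw [coherentWeight, if_pos (by omega), ← h1,
      ← sum_range_reflect (fun r => a.choose r * (k - i).choose (a - r))]
    push_cast
    symm
    rw [← sum_subset (s₁ := range (min a k + 1)) (range_subset_range.2 (by omega))]
    · refine sum_congr rfl fun l hl => ?_
      rw [mem_range] at hl
      have e2 : a - (a - l) = l := by omega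
      rw [e2, Nat.choose_symm (by omega), coherentWeight]
      split_ifs with h3
      · rfl
      · rw [Nat.choose_eq_zero_of_lt (show k - i < l by omega), Nat.cast_zero]
    · intro l hl hl'
      rw [mem_range] at hl hl'
      have e2 : a - (a - l) = l := by omega
      rw [e2, Nat.choose_eq_zero_of_lt (show k - i < l by omega), Nat.cast_zero, mul_zero]
  · rw [coherentWeight, if_neg (by omega)]
    refine sum_eq_zero fun l _ => ?_
    rw [coherentWeight, if_neg (by omega), mul_zero]

theorem exists_sum_vecMulVec {n : Type*} [Fintype n] {A : Matrix n n ℂ} (hA : A.PosSemidef) :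
    ∃ v : n → n → ℂ, A = ∑ i, vecMulVec (v i) (star (v i)) := by
  classical
  open scoped MatrixOrder in
  obtain ⟨C, rfl⟩ := CStarAlgebra.nonneg_iff_eq_star_mul_self.mp hA.nonneg
  refine ⟨fun i => star (C i), ?_⟩
  ext x y
  simp [Matrix.mul_apply, Matrix.sum_apply, vecMulVec_apply, star_apply]

/-- With no bosons the input is a scalar and the output a multiple of the identity, so the bound is
`tr Q ≤ min n (b + 1)`. -/
theorem topSumLe_amplify_zero {b n : ℕ} {ρ : Matrix (Fin 1) (Fin 1) ℂ} (hρ : ρ.PosSemidef) :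
    TopSumLe (amplify 0 b ρ) n (ρ.trace.re * ∑ i ∈ range n, coherentWeight 0 b i) := by
  have h1 : amplify 0 b ρ = ρ 0 0 • (1 : Matrix (Fin (b + 1)) (Fin (b + 1)) ℂ) := by
    have h2 : ρ = ρ 0 0 • (1 : Matrix (Fin 1) (Fin 1) ℂ) := by
      ext i j
      fin_cases i
      fin_cases j
      simp
    have h3 := sum_krausOp_mul_conjTranspose (Nat.zero_le b)
    rw [Nat.choose_zero_right, Nat.cast_one, one_smul] at h3
    rw [amplify, h2]
    simp only [Matrix.mul_smul, Matrix.smul_mul, Matrix.mul_one, ← smul_sum]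
    rw [h3]
    simp
  have htr : ρ.trace = ρ 0 0 := by simp [trace]
  have hpos := Complex.le_def.1 (hρ.diag_nonneg (i := 0))
  intro Q hQ1 hQ2 hQ3
  have h4 : (Q * amplify 0 b ρ).trace.re = ρ.trace.re * Q.trace.re := by
    rw [h1, Matrix.mul_smul, Matrix.mul_one, trace_smul, smul_eq_mul, Complex.mul_re, htr]
    have := hpos.2
    simp only [Complex.zero_im] at this
    rw [← this]
    ring
  rw [h4]
  apply mul_le_mul_of_nonneg_left _ (htr ▸ hpos.1)
  have h5 : Q.trace.re ≤ b + 1 := by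
    have := (Complex.le_def.1 hQ2.trace_nonneg).1
    rw [trace_sub, trace_one, Fintype.card_fin] at this
    simp at this
    linarith
  have h6 : ∑ i ∈ range n, coherentWeight 0 b i = min (n : ℝ) (b + 1) := by
    simp only [coherentWeight, add_zero, Nat.choose_zero_right, Nat.cast_one]
    rw [← sum_filter, sum_const, nsmul_eq_mul, mul_one]
    have : (range n).filter (fun i => i ≤ b) = range (min n (b + 1)) := by
      ext i
      simp only [mem_filter, mem_range]
      omega
    rw [this, card_range]
    exact_mod_cast rfl
  rw [h6]
  exact le_min hQ3 h5

/-- The eigenvalues of the image of a state are majorized by those of a coherent state. -/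
theorem topSumLe_amplify {a b : ℕ} (hab : a ≤ b) {ρ : Matrix (Fin (a + 1)) (Fin (a + 1)) ℂ}
    (hρ : ρ.PosSemidef) (n : ℕ) :
    TopSumLe (amplify a b ρ) n (ρ.trace.re * ∑ i ∈ range n, coherentWeight a b i) := by
  obtain ⟨k, rfl⟩ := Nat.exists_eq_add_of_le hab
  clear hab
  -- The induction is on the number of added bosons, with `a` free, because the hypothesis is
  -- applied to inputs of `l` bosons.
  induction k using Nat.strong_induction_on generalizing a with
  | _ k ih =>
  obtain ⟨v, rfl⟩ := exists_sum_vecMulVec hρ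
  rw [amplify_sum, trace_sum, Complex.re_sum, sum_mul]
  refine TopSumLe.sum fun j _ => ?_
  set w := v j
  rw [← krausCols_mul_conjTranspose rfl]
  apply TopSumLe.mul_conjTranspose
  rw [conjTranspose_mul_krausCols rfl]
  set γ := vecMulVec w (star w)
  have hγ : γ.PosSemidef := posSemidef_vecMulVec_self_star w
  have hx : γ.trace.re * ∑ i ∈ range n, coherentWeight a (a + k) i =
      ∑ l ∈ range (min a k + 1),
        (reduce l a γ).trace.re * ∑ i ∈ range n, coherentWeight l k i := by
    have h1 : ∀ l ∈ range (min a k + 1),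
        (reduce l a γ).trace.re * ∑ i ∈ range n, coherentWeight l k i =
        γ.trace.re * ∑ i ∈ range n, (a.choose l : ℝ) * coherentWeight l k i := by
      intro l hl
      rw [mem_range] at hl
      rw [trace_reduce (by omega), ← mul_sum, ← Complex.ofReal_natCast, Complex.re_ofReal_mul]
      ring
    rw [sum_congr rfl h1, ← mul_sum, sum_comm]
    simp only [sum_choose_mul_coherentWeight rfl]
  rw [hx]
  refine TopSumLe.sum fun l hl => ?_
  rw [mem_range] at hl
  have hγl : (reduce l a γ).PosSemidef := posSemidef_reduce hγ
  -- For `l = 0` the number `k - l` of added bosons does not drop, so this term is bounded directly.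
  rcases Nat.eq_zero_or_pos l with rfl | hl0
  · exact topSumLe_amplify_zero hγl
  · have h2 := ih (k - l) (by omega) hγl
    rwa [Nat.add_sub_of_le (by omega)] at h2

end

section

open Finset Matrix Real

/-! ### Eigenprojections -/

/-- `P` is the orthogonal projection onto the eigenspace of `A` for the eigenvalue `μ`. -/
structure IsEigenProj {n : Type*} [Fintype n] [DecidableEq n] (A : Matrix n n ℂ) (μ : ℂ)
    (P : Matrix n n ℂ) : Prop where
  isHermitian : P.IsHermitian
  mul_eq : A * P = μ • P
  mulVec_eq : ∀ v : n → ℂ, A *ᵥ v = μ • v → P *ᵥ v = v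

variable {n : Type*} [Fintype n] [DecidableEq n]

/-- `P v` lies in the eigenspace, and `⟨P v, w⟩ = ⟨v, P w⟩ = ⟨v, w⟩` for `w` in it. The algebraic
conditions transport easily under conjugation and reindexing. -/
theorem IsEigenProj.eigenProj_eq {A P : Matrix n n ℂ} {μ : ℂ} (h : IsEigenProj A μ P) :
    eigenProj A μ = P := by
  rw [eigenProj, StarAlgEquiv.symm_apply_eq]
  ext1 v
  apply Submodule.eq_starProjection_of_mem_of_inner_eq_zero
  · rw [Module.End.mem_eigenspace_iff]
    have h1 : A *ᵥ (P *ᵥ v.ofLp) = μ • (P *ᵥ v.ofLp) := by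
      rw [mulVec_mulVec, h.mul_eq, smul_mulVec]
    exact (WithLp.ofLp_injective 2) h1
  · intro w hw
    rw [Module.End.mem_eigenspace_iff] at hw
    have hw' : A *ᵥ w.ofLp = μ • w.ofLp := congrArg WithLp.ofLp hw
    have h2 : star (P *ᵥ v.ofLp) = star v.ofLp ᵥ* P := by rw [star_mulVec, h.isHermitian]
    rw [inner_sub_left, EuclideanSpace.inner_eq_star_dotProduct,
      EuclideanSpace.inner_eq_star_dotProduct, ofLp_toEuclideanCLM, h2, dotProduct_comm _ (_ ᵥ* _),
      ← dotProduct_mulVec, h.mulVec_eq _ hw', dotProduct_comm, sub_self]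

theorem IsEigenProj.conj {A P U : Matrix n n ℂ} {μ : ℂ} (h : IsEigenProj A μ P)
    (hU : Uᴴ * U = 1) : IsEigenProj (U * A * Uᴴ) μ (U * P * Uᴴ) := by
  have hU' : U * Uᴴ = 1 := mul_eq_one_comm.1 hU
  refine ⟨?_, ?_, ?_⟩
  · rw [Matrix.IsHermitian, conjTranspose_mul, conjTranspose_mul, conjTranspose_conjTranspose,
      h.isHermitian, Matrix.mul_assoc]
  · calc U * A * Uᴴ * (U * P * Uᴴ) = U * (A * (Uᴴ * U) * P) * Uᴴ := by
          simp only [Matrix.mul_assoc]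
      _ = μ • (U * P * Uᴴ) := by
          rw [hU, Matrix.mul_one, h.mul_eq, Matrix.mul_smul, Matrix.smul_mul]
  · intro v hv
    have h1 : A *ᵥ (Uᴴ *ᵥ v) = μ • (Uᴴ *ᵥ v) := by
      have h2 := congrArg (fun x => Uᴴ *ᵥ x) hv
      simp only [mulVec_mulVec, mulVec_smul] at h2
      rw [← Matrix.mul_assoc, ← Matrix.mul_assoc, hU, Matrix.one_mul] at h2
      rw [mulVec_mulVec, h2]
    have h3 := h.mulVec_eq _ h1
    rw [Matrix.mul_assoc, ← mulVec_mulVec, ← mulVec_mulVec, h3, mulVec_mulVec, hU', one_mulVec]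

theorem IsEigenProj.submatrix {m : Type*} [Fintype m] [DecidableEq m] {A P : Matrix n n ℂ} {μ : ℂ}
    (h : IsEigenProj A μ P) (e : m ≃ n) :
    IsEigenProj (A.submatrix e e) μ (P.submatrix e e) := by
  refine ⟨h.isHermitian.submatrix e, ?_, ?_⟩
  · rw [submatrix_mul_equiv, h.mul_eq]
    rfl
  · intro v hv
    have h1 : A *ᵥ (v ∘ e.symm) = μ • (v ∘ e.symm) := by
      rw [submatrix_mulVec_equiv] at hv
      ext i
      have := congrFun hv (e.symm i)
      simpa using this
    rw [submatrix_mulVec_equiv, h.mulVec_eq _ h1]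
    ext i
    simp

/-! ### Commutation relations -/

theorem spinPlus_apply (a : ℕ) (i j : Fin (a + 1)) : spinPlus a i j =
    if (i : ℕ) + 1 = j then ((√(((j : ℕ) : ℝ) * ((a : ℝ) + 1 - (j : ℕ))) : ℝ) : ℂ) else 0 := rfl

theorem spinMinus_apply (a : ℕ) (i j : Fin (a + 1)) : spinMinus a i j =
    if (j : ℕ) + 1 = i then ((√(((i : ℕ) : ℝ) * ((a : ℝ) + 1 - (i : ℕ))) : ℝ) : ℂ) else 0 := by
  rw [spinMinus, conjTranspose_apply, spinPlus_apply]
  split_ifs <;> simp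

theorem spinZ_mul_spinPlus (a : ℕ) : spinZ a * spinPlus a = spinPlus a * spinZ a + spinPlus a := by
  ext i j
  rw [spinZ, diagonal_mul, Matrix.add_apply, mul_diagonal, spinPlus_apply]
  split_ifs with h
  · rw [← h]
    push_cast
    ring
  · simp

theorem spinZ_mul_spinMinus (a : ℕ) :
    spinZ a * spinMinus a = spinMinus a * spinZ a - spinMinus a := by
  ext i j
  rw [spinZ, diagonal_mul, Matrix.sub_apply, mul_diagonal, spinMinus_apply]
  split_ifs with h
  · rw [← h]
    push_cast
    ring
  · simp

/-! ### Boson operators and the spin operators built from them. -/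

/-- Annihilation of a boson of the first mode. -/
def annihilateFst (a : ℕ) : Matrix (Fin a) (Fin (a + 1)) ℂ :=
  Matrix.of fun i j => if (j : ℕ) = i then ((√((a : ℝ) - (i : ℕ)) : ℝ) : ℂ) else 0

/-- Annihilation of a boson of the second mode. -/
def annihilateSnd (a : ℕ) : Matrix (Fin a) (Fin (a + 1)) ℂ :=
  Matrix.of fun i j => if (j : ℕ) = i + 1 then ((√((i : ℕ) + 1 : ℝ) : ℝ) : ℂ) else 0

/-- The number operator of the second mode. -/
def numberOp (a : ℕ) : Matrix (Fin (a + 1)) (Fin (a + 1)) ℂ := diagonal fun i => ((i : ℕ) : ℂ)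

theorem spinZ_eq (a : ℕ) : spinZ a = ((a : ℂ) / 2) • 1 - numberOp a := by
  rw [spinZ, numberOp, smul_one_eq_diagonal, diagonal_sub]

theorem sum_ite_shift_mul {N : ℕ} (i j s t : ℕ) (c d : ℕ → ℂ) :
    ∑ r : Fin N, (if i = r + s then c r else 0) * (if j = r + t then d r else 0) =
      if s ≤ i ∧ i < N + s ∧ j + s = i + t then c (i - s) * d (i - s) else 0 := by
  rw [Fin.sum_univ_eq_sum_range
    (fun r => (if i = r + s then c r else 0) * (if j = r + t then d r else 0))]
  split_ifs with h
  · rw [sum_eq_single (i - s)]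
    · rw [if_pos (by omega), if_pos (by omega)]
    · intro r _ hr
      rw [if_neg (by omega), zero_mul]
    · intro hr
      rw [mem_range] at hr
      omega
  · refine sum_eq_zero fun r hr => ?_
    rw [mem_range] at hr
    by_cases h1 : i = r + s
    · rw [if_neg (show ¬ j = r + t by omega), mul_zero]
    · rw [if_neg h1, zero_mul]

theorem sum_ite_mul_ite {N : ℕ} (i j : ℕ) (c d : ℂ) :
    ∑ r : Fin N, (if (r : ℕ) = i then c else 0) * (if (r : ℕ) = j then d else 0) =
      if i < N ∧ i = j then c * d else 0 := by
  rw [Fin.sum_univ_eq_sum_range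
    (fun r => (if r = i then c else 0) * (if r = j then d else 0))]
  split_ifs with h
  · rw [sum_eq_single i]
    · rw [if_pos rfl, if_pos h.2]
    · intro r _ hr
      rw [if_neg hr, zero_mul]
    · intro hr
      rw [mem_range] at hr
      omega
  · refine sum_eq_zero fun r hr => ?_
    rw [mem_range] at hr
    by_cases h1 : r = i
    · rw [if_neg (show ¬ r = j by omega), mul_zero]
    · rw [if_neg h1, zero_mul]

/-- Creation of a boson of the first mode. -/
def createFst (b : ℕ) : Matrix (Fin (b + 2)) (Fin (b + 1)) ℂ :=
  Matrix.of fun i j => if (i : ℕ) = j then ((√((b : ℝ) + 1 - (j : ℕ)) : ℝ) : ℂ) else 0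

/-- Creation of a boson of the second mode. -/
def createSnd (b : ℕ) : Matrix (Fin (b + 2)) (Fin (b + 1)) ℂ :=
  Matrix.of fun i j => if (i : ℕ) = j + 1 then ((√((j : ℕ) + 1 : ℝ) : ℝ) : ℂ) else 0

theorem spinMinus_mul_spinPlus_apply (a : ℕ) (i j : Fin (a + 1)) :
    (spinMinus a * spinPlus a) i j =
      if i = j then ((i : ℕ) : ℂ) * (a + 1 - (i : ℕ)) else 0 := by
  have hi := i.2
  have h2 : ∀ r : Fin (a + 1), spinMinus a i r * spinPlus a r j =
      (if (i : ℕ) = r + 1 then ((√(((i : ℕ) : ℝ) * ((a : ℝ) + 1 - (i : ℕ))) : ℝ) : ℂ) else 0) *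
      (if (j : ℕ) = r + 1 then ((√(((j : ℕ) : ℝ) * ((a : ℝ) + 1 - (j : ℕ))) : ℝ) : ℂ) else 0) := by
    intro r
    rw [spinPlus_apply, spinMinus_apply]
    congr 1
    · split_ifs with h3 h4 <;> first | omega | rfl
    · split_ifs with h3 h4 <;> first | omega | rfl
  rw [Matrix.mul_apply, sum_congr rfl fun r _ => h2 r, sum_ite_shift_mul _ _ _ _
    (fun _ => ((√(((i : ℕ) : ℝ) * ((a : ℝ) + 1 - (i : ℕ))) : ℝ) : ℂ))
    (fun _ => ((√(((j : ℕ) : ℝ) * ((a : ℝ) + 1 - (j : ℕ))) : ℝ) : ℂ))]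
  by_cases hij : i = j
  · subst hij
    rw [if_pos rfl]
    have hle : ((i : ℕ) : ℝ) ≤ a := by exact_mod_cast Nat.lt_succ_iff.1 hi
    rw [← Complex.ofReal_mul, Real.mul_self_sqrt
      (mul_nonneg (Nat.cast_nonneg _) (by linarith))]
    split_ifs with h4
    · push_cast
      ring
    · have : (i : ℕ) = 0 := by omega
      rw [this]
      simp
  · rw [if_neg hij, if_neg]
    rintro ⟨-, -, h⟩
    exact hij (Fin.ext (by omega))

theorem spinPlus_mul_spinMinus (a : ℕ) :
    spinPlus a * spinMinus a = spinMinus a * spinPlus a + (2 : ℂ) • spinZ a := by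
  ext i j
  have hi := i.2
  have h1 : (spinPlus a * spinMinus a) i j =
      if i = j then ((i : ℕ) + 1 : ℂ) * (a - (i : ℕ)) else 0 := by
    have h2 : ∀ r : Fin (a + 1), spinPlus a i r * spinMinus a r j =
        (if (r : ℕ) = i + 1 then ((√((((i : ℕ) + 1 : ℕ) : ℝ) * ((a : ℝ) + 1 - ((i : ℕ) + 1 : ℕ))) :
          ℝ) : ℂ) else 0) * (if (r : ℕ) = j + 1 then
          ((√((((j : ℕ) + 1 : ℕ) : ℝ) * ((a : ℝ) + 1 - ((j : ℕ) + 1 : ℕ))) : ℝ) : ℂ) else 0) := by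
      intro r
      rw [spinPlus_apply, spinMinus_apply]
      congr 1
      · split_ifs with h3 h4 <;> first | omega | rfl | rw [h3]
      · split_ifs with h3 h4 <;> first | omega | rfl | rw [h3]
    rw [Matrix.mul_apply, sum_congr rfl fun r _ => h2 r, sum_ite_mul_ite]
    by_cases hij : i = j
    · subst hij
      rw [if_pos rfl]
      have hle : ((i : ℕ) : ℝ) ≤ a := by exact_mod_cast Nat.lt_succ_iff.1 hi
      rw [← Complex.ofReal_mul, Real.mul_self_sqrt
        (mul_nonneg (Nat.cast_nonneg _) (by push_cast; linarith))]
      split_ifs with h4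
      · push_cast
        ring
      · have : (i : ℕ) = a := by omega
        rw [this]
        simp
    · rw [if_neg hij, if_neg]
      rintro ⟨-, h⟩
      exact hij (Fin.ext (by omega))
  rw [Matrix.add_apply, Matrix.smul_apply, h1, spinMinus_mul_spinPlus_apply, spinZ]
  by_cases hij : i = j
  · subst hij
    rw [if_pos rfl, if_pos rfl, diagonal_apply_eq, smul_eq_mul]
    ring
  · rw [if_neg hij, if_neg hij, diagonal_apply_ne _ hij]
    simp

theorem annihilateFst_apply (a : ℕ) (r : Fin a) (i : Fin (a + 1)) : annihilateFst a r i =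
    if (i : ℕ) = r + 0 then ((√((a : ℝ) - (r : ℕ)) : ℝ) : ℂ) else 0 := rfl

theorem annihilateSnd_apply (a : ℕ) (r : Fin a) (i : Fin (a + 1)) : annihilateSnd a r i =
    if (i : ℕ) = r + 1 then ((√(((r : ℕ) : ℝ) + 1) : ℝ) : ℂ) else 0 := rfl

theorem annihilateFst_conjTranspose_apply (a : ℕ) (r : Fin a) (i : Fin (a + 1)) :
    (annihilateFst a)ᴴ i r =
      if (i : ℕ) = r + 0 then ((√((a : ℝ) - (r : ℕ)) : ℝ) : ℂ) else 0 := by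
  rw [conjTranspose_apply, annihilateFst_apply]
  split_ifs <;> simp

theorem annihilateSnd_conjTranspose_apply (a : ℕ) (r : Fin a) (i : Fin (a + 1)) :
    (annihilateSnd a)ᴴ i r =
      if (i : ℕ) = r + 1 then ((√(((r : ℕ) : ℝ) + 1) : ℝ) : ℂ) else 0 := by
  rw [conjTranspose_apply, annihilateSnd_apply]
  split_ifs <;> simp

theorem createFst_apply (b : ℕ) (r : Fin (b + 2)) (i : Fin (b + 1)) : createFst b r i =
    if (r : ℕ) = i then ((√((b : ℝ) + 1 - (i : ℕ)) : ℝ) : ℂ) else 0 := rfl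

theorem createSnd_apply (b : ℕ) (r : Fin (b + 2)) (i : Fin (b + 1)) : createSnd b r i =
    if (r : ℕ) = i + 1 then ((√((i : ℕ) + 1 : ℝ) : ℝ) : ℂ) else 0 := rfl

theorem createFst_conjTranspose_apply (b : ℕ) (r : Fin (b + 2)) (i : Fin (b + 1)) :
    (createFst b)ᴴ i r =
      if (r : ℕ) = i then ((√((b : ℝ) + 1 - (i : ℕ)) : ℝ) : ℂ) else 0 := by
  rw [conjTranspose_apply, createFst, of_apply]
  split_ifs <;> simp

theorem createSnd_conjTranspose_apply (b : ℕ) (r : Fin (b + 2)) (i : Fin (b + 1)) :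
    (createSnd b)ᴴ i r =
      if (r : ℕ) = i + 1 then ((√((i : ℕ) + 1 : ℝ) : ℝ) : ℂ) else 0 := by
  rw [conjTranspose_apply, createSnd, of_apply]
  split_ifs <;> simp

theorem annihilateFst_gram (a : ℕ) :
    (annihilateFst a)ᴴ * annihilateFst a = (a : ℂ) • 1 - numberOp a := by
  ext i j
  have hle : ((i : ℕ) : ℝ) ≤ a := by exact_mod_cast Nat.lt_succ_iff.1 i.2
  simp only [Matrix.mul_apply, annihilateFst_conjTranspose_apply, annihilateFst_apply]
  rw [sum_ite_shift_mul _ _ _ _ (fun r => ((√((a : ℝ) - r) : ℝ) : ℂ))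
    (fun r => ((√((a : ℝ) - r) : ℝ) : ℂ)), numberOp, smul_one_eq_diagonal, diagonal_sub]
  by_cases hij : i = j
  · subst hij
    rw [diagonal_apply_eq, Nat.sub_zero, ← Complex.ofReal_mul, Real.mul_self_sqrt (by linarith)]
    split_ifs with h
    · push_cast
      ring
    · have h1 : (i : ℕ) = a := by omega
      rw [h1, sub_self]
  · rw [diagonal_apply_ne _ hij, if_neg]
    rintro ⟨-, -, h⟩
    exact hij (Fin.ext (by omega))

theorem annihilateSnd_gram (a : ℕ) : (annihilateSnd a)ᴴ * annihilateSnd a = numberOp a := by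
  ext i j
  simp only [Matrix.mul_apply, annihilateSnd_conjTranspose_apply, annihilateSnd_apply]
  rw [sum_ite_shift_mul _ _ _ _ (fun r => ((√((r : ℝ) + 1) : ℝ) : ℂ))
    (fun r => ((√((r : ℝ) + 1) : ℝ) : ℂ)), numberOp]
  by_cases hij : i = j
  · subst hij
    rw [diagonal_apply_eq, ← Complex.ofReal_mul, Real.mul_self_sqrt (by positivity)]
    split_ifs with h
    · rw [Nat.cast_sub h.1]
      push_cast
      ring
    · have h1 : (i : ℕ) = 0 := by omega
      rw [h1, Nat.cast_zero]
  · rw [diagonal_apply_ne _ hij, if_neg]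
    rintro ⟨-, -, h⟩
    exact hij (Fin.ext (by omega))

/-- Schwinger's representation: raising the spin moves a boson from the second mode to the first. -/
theorem annihilateFst_mul_annihilateSnd (a : ℕ) :
    (annihilateFst a)ᴴ * annihilateSnd a = spinPlus a := by
  ext i j
  simp only [Matrix.mul_apply, annihilateFst_conjTranspose_apply, annihilateSnd_apply]
  rw [sum_ite_shift_mul _ _ _ _ (fun r => ((√((a : ℝ) - r) : ℝ) : ℂ))
    (fun r => ((√((r : ℝ) + 1) : ℝ) : ℂ)), spinPlus_apply]
  by_cases hij : (i : ℕ) + 1 = j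
  · have hle : ((i : ℕ) : ℝ) + 1 ≤ a := by
      have := j.2
      exact_mod_cast (show (i : ℕ) + 1 ≤ a by omega)
    rw [if_pos hij, if_pos (by have := j.2; omega), ← hij, ← Complex.ofReal_mul, Nat.sub_zero,
      mul_comm, ← Real.sqrt_mul (by positivity)]
    push_cast
    ring_nf
  · rw [if_neg hij, if_neg]
    omega

theorem createFst_gram (b : ℕ) :
    (createFst b)ᴴ * createFst b = ((b : ℂ) + 1) • 1 - numberOp b := by
  ext i j
  have hle : ((i : ℕ) : ℝ) ≤ b := by exact_mod_cast Nat.lt_succ_iff.1 i.2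
  simp only [Matrix.mul_apply, createFst_conjTranspose_apply, createFst_apply]
  rw [sum_ite_mul_ite, numberOp, smul_one_eq_diagonal, diagonal_sub]
  by_cases hij : i = j
  · subst hij
    rw [diagonal_apply_eq, ← Complex.ofReal_mul, Real.mul_self_sqrt (by linarith),
      if_pos (by have := i.2; omega)]
    push_cast
    ring
  · rw [diagonal_apply_ne _ hij, if_neg]
    rintro ⟨-, h⟩
    exact hij (Fin.ext h)

theorem createSnd_gram (b : ℕ) : (createSnd b)ᴴ * createSnd b = 1 + numberOp b := by
  ext i j
  simp only [Matrix.mul_apply, createSnd_conjTranspose_apply, createSnd_apply]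
  rw [sum_ite_mul_ite, numberOp, ← diagonal_one, diagonal_add]
  by_cases hij : i = j
  · subst hij
    rw [diagonal_apply_eq, ← Complex.ofReal_mul, Real.mul_self_sqrt (by positivity),
      if_pos (by have := i.2; omega)]
    push_cast
    ring
  · rw [diagonal_apply_ne _ hij, if_neg]
    rintro ⟨-, h⟩
    exact hij (Fin.ext (by omega))

theorem createFst_mul_createSnd (b : ℕ) : (createFst b)ᴴ * createSnd b = spinMinus b := by
  ext i j
  simp only [Matrix.mul_apply, createFst_conjTranspose_apply, createSnd_apply]
  rw [sum_ite_mul_ite, spinMinus_apply]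
  by_cases hij : (j : ℕ) + 1 = i
  · have hle : ((j : ℕ) : ℝ) + 1 ≤ b := by
      have := i.2
      exact_mod_cast (show (j : ℕ) + 1 ≤ b by omega)
    rw [if_pos hij, if_pos (by have := i.2; omega), ← hij, ← Complex.ofReal_mul,
      mul_comm, ← Real.sqrt_mul (by positivity)]
    push_cast
    ring_nf
  · rw [if_neg hij, if_neg]
    omega

/-! ### The polarization operator and the square of the total spin. -/

/-- The polarization operator, which moves one boson from the first factor to the second. Its
kernel consists of the vectors of minimal total spin. -/
def polarization (a b : ℕ) : Matrix (Fin a × Fin (b + 2)) (Fin (a + 1) × Fin (b + 1)) ℂ :=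
  annihilateFst a ⊗ₖ createFst b + annihilateSnd a ⊗ₖ createSnd b

theorem spinY_eq (a : ℕ) : spinY a = (-(Complex.I / 2)) • (spinPlus a - spinMinus a) := by
  rw [spinY]
  congr 1
  rw [div_eq_iff (by simp)]
  linear_combination Complex.I_mul_I

theorem spinX_kronecker_add_spinY_kronecker (a b : ℕ) :
    spinX a ⊗ₖ spinX b + spinY a ⊗ₖ spinY b =
      (1 / 2 : ℂ) • (spinPlus a ⊗ₖ spinMinus b + spinMinus a ⊗ₖ spinPlus b) := by
  ext ⟨p, p'⟩ ⟨q, q'⟩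
  simp only [spinX, spinY_eq, Matrix.add_apply, Matrix.smul_apply, Matrix.sub_apply,
    kronecker_apply, smul_eq_mul]
  linear_combination (spinPlus a p q - spinMinus a p q) *
    (spinPlus b p' q' - spinMinus b p' q') / 4 * Complex.I_mul_I

theorem spinMinus_mul_spinPlus (a : ℕ) :
    spinMinus a * spinPlus a = numberOp a * (((a : ℂ) + 1) • 1 - numberOp a) := by
  ext i j
  rw [spinMinus_mul_spinPlus_apply, numberOp, smul_one_eq_diagonal, diagonal_sub,
    diagonal_mul_diagonal, diagonal_apply]

theorem spinSq_eq (a : ℕ) : spinX a * spinX a + spinY a * spinY a + spinZ a * spinZ a =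
    ((a : ℂ) / 2 * ((a : ℂ) / 2 + 1)) • 1 := by
  have h1 : spinX a * spinX a + spinY a * spinY a =
      (1 / 2 : ℂ) • (spinPlus a * spinMinus a + spinMinus a * spinPlus a) := by
    rw [spinX, spinY_eq]
    simp only [Matrix.smul_mul, Matrix.mul_smul, Matrix.mul_add, Matrix.add_mul, Matrix.mul_sub,
      Matrix.sub_mul]
    have h2 : -(Complex.I / 2) * -(Complex.I / 2) = (-1 / 4 : ℂ) := by
      linear_combination Complex.I_mul_I / 4
    linear_combination (norm := module) h2 • (spinPlus a * spinPlus a - spinMinus a * spinPlus a -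
      spinPlus a * spinMinus a + spinMinus a * spinMinus a)
  rw [h1, spinPlus_mul_spinMinus, spinMinus_mul_spinPlus, spinZ_eq]
  simp only [Matrix.smul_mul, Matrix.mul_smul, Matrix.mul_sub, Matrix.sub_mul, Matrix.one_mul,
    Matrix.mul_one]
  module

/-- The cross terms of the Gram matrix are `S_+ ⊗ S_- + S_- ⊗ S_+`, the off-diagonal part of twice
the scalar product of the spins; the diagonal terms are number operators and match the rest. Hence
the eigenvectors of minimal total spin are exactly the kernel of the polarization. -/
theorem conjTranspose_mul_polarization {a b : ℕ} (hab : a ≤ b) :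
    (polarization a b)ᴴ * polarization a b =
      totalSpinSq a b - ((minSpin a b * (minSpin a b + 1) : ℝ) : ℂ) • 1 := by
  have h1 : totalSpinSq a b =
      (spinX a * spinX a + spinY a * spinY a + spinZ a * spinZ a) ⊗ₖ
        (1 : Matrix (Fin (b + 1)) (Fin (b + 1)) ℂ) +
      (1 : Matrix (Fin (a + 1)) (Fin (a + 1)) ℂ) ⊗ₖ
        (spinX b * spinX b + spinY b * spinY b + spinZ b * spinZ b) +
      (2 : ℂ) • ((spinX a ⊗ₖ spinX b + spinY a ⊗ₖ spinY b) + spinZ a ⊗ₖ spinZ b) := by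
    simp only [totalSpinSq, totalSpin, sq, Matrix.mul_add, Matrix.add_mul, ← mul_kronecker_mul,
      Matrix.one_mul, Matrix.mul_one, add_kronecker, kronecker_add]
    module
  have hms : minSpin a b = ((b : ℝ) - a) / 2 := by
    have : (a : ℝ) ≤ b := by exact_mod_cast hab
    rw [minSpin, abs_of_nonneg (by linarith)]
    ring
  have hPM : (annihilateSnd a)ᴴ * annihilateFst a = spinMinus a := by
    rw [spinMinus, ← annihilateFst_mul_annihilateSnd, conjTranspose_mul,
      conjTranspose_conjTranspose]
  have hMP : (createSnd b)ᴴ * createFst b = spinPlus b := by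
    have := congrArg conjTranspose (createFst_mul_createSnd b)
    rwa [conjTranspose_mul, conjTranspose_conjTranspose, spinMinus, conjTranspose_conjTranspose]
      at this
  rw [h1, spinSq_eq, spinSq_eq, spinX_kronecker_add_spinY_kronecker, polarization, hms,
    conjTranspose_add, conjTranspose_kronecker, conjTranspose_kronecker]
  simp only [Matrix.mul_add, Matrix.add_mul, ← mul_kronecker_mul]
  rw [annihilateFst_gram, annihilateSnd_gram, annihilateFst_mul_annihilateSnd, createFst_gram,
    createSnd_gram, createFst_mul_createSnd, hPM, hMP, spinZ_eq, spinZ_eq]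
  ext ⟨p, p'⟩ ⟨q, q'⟩
  simp only [Matrix.add_apply, Matrix.smul_apply, Matrix.sub_apply, kronecker_apply, smul_eq_mul]
  have h2 : (1 : Matrix (Fin (a + 1) × Fin (b + 1)) (Fin (a + 1) × Fin (b + 1)) ℂ)
      (p, p') (q, q') = (1 : Matrix (Fin (a + 1)) (Fin (a + 1)) ℂ) p q *
        (1 : Matrix (Fin (b + 1)) (Fin (b + 1)) ℂ) p' q' := by
    rw [← kronecker_apply, one_kronecker_one]
  rw [h2]
  push_cast
  ring

end

section

open Finset Matrix Real

/-! ### The vectors of minimal total spin -/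

theorem createFst_sum (b : ℕ) (c : Fin (b + 2)) (g : ℕ → ℂ) :
    ∑ j : Fin (b + 1), createFst b c j * g j = ((√((b : ℝ) + 1 - (c : ℕ)) : ℝ) : ℂ) * g c := by
  simp only [createFst_apply, ite_mul, zero_mul]
  rw [Fin.sum_univ_eq_sum_range (fun j => if (c : ℕ) = j then
    ((√((b : ℝ) + 1 - (j : ℕ)) : ℝ) : ℂ) * g j else 0), sum_ite_eq]
  split_ifs with h
  · rfl
  · have : (c : ℕ) = b + 1 := by
      rw [mem_range] at h
      omega
    rw [this]
    simp

theorem createSnd_sum (b : ℕ) (c : Fin (b + 2)) (g : ℕ → ℂ) :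
    ∑ j : Fin (b + 1), createSnd b c j * g j = ((√((c : ℕ) : ℝ) : ℝ) : ℂ) * g (c - 1) := by
  simp only [createSnd_apply, ite_mul, zero_mul]
  rw [Fin.sum_univ_eq_sum_range (fun j => if (c : ℕ) = j + 1 then
    ((√((j : ℕ) + 1 : ℝ) : ℝ) : ℂ) * g j else 0)]
  by_cases h : (c : ℕ) = 0
  · rw [h, sum_eq_zero]
    · simp
    · intro j _
      rw [if_neg (by omega)]
  · have hc := c.2
    rw [sum_eq_single ((c : ℕ) - 1)]
    · rw [if_pos (by omega), Nat.cast_sub (by omega)]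
      simp
    · intro j _ hj
      rw [if_neg (by omega)]
    · intro hj
      rw [mem_range] at hj
      omega

theorem annihilateFst_sum (a : ℕ) (r : Fin a) (g : ℕ → ℂ) :
    ∑ i : Fin (a + 1), annihilateFst a r i * g i = ((√((a : ℝ) - (r : ℕ)) : ℝ) : ℂ) * g r := by
  simp only [annihilateFst_apply, ite_mul, zero_mul, add_zero]
  rw [Fin.sum_univ_eq_sum_range (fun i => if i = (r : ℕ) then
    ((√((a : ℝ) - (r : ℕ)) : ℝ) : ℂ) * g i else 0), sum_ite_eq', if_pos]
  rw [mem_range]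
  omega

theorem annihilateSnd_sum (a : ℕ) (r : Fin a) (g : ℕ → ℂ) :
    ∑ i : Fin (a + 1), annihilateSnd a r i * g i = ((√((r : ℕ) + 1 : ℝ) : ℝ) : ℂ) * g (r + 1) := by
  simp only [annihilateSnd_apply, ite_mul, zero_mul]
  rw [Fin.sum_univ_eq_sum_range (fun i => if i = (r : ℕ) + 1 then
    ((√((r : ℕ) + 1 : ℝ) : ℝ) : ℂ) * g i else 0), sum_ite_eq', if_pos]
  rw [mem_range]
  omega

/-- Using functions on all of `ℕ × ℕ` avoids boundary cases: the out-of-range entries at `c = 0` and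
`c = b + 1` carry the factor `√0`. -/
theorem polarization_mulVec_apply {a b : ℕ} (g : ℕ → ℕ → ℂ) (r : Fin a) (c : Fin (b + 2)) :
    (polarization a b *ᵥ fun p => g p.1 p.2) (r, c) =
      ((√((a : ℝ) - (r : ℕ)) : ℝ) : ℂ) * (((√((b : ℝ) + 1 - (c : ℕ)) : ℝ) : ℂ) * g r c) +
      ((√((r : ℕ) + 1 : ℝ) : ℝ) : ℂ) * (((√((c : ℕ) : ℝ) : ℝ) : ℂ) * g (r + 1) (c - 1)) := by
  simp only [mulVec, dotProduct, polarization, Matrix.add_apply, kronecker_apply, add_mul,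
    sum_add_distrib, Fintype.sum_prod_type, mul_assoc, ← mul_sum]
  congr 1
  · simp only [createFst_sum]
    exact annihilateFst_sum a r fun i => ((√((b : ℝ) + 1 - (c : ℕ)) : ℝ) : ℂ) * g i c
  · simp only [createSnd_sum]
    exact annihilateSnd_sum a r fun i => ((√((c : ℕ) : ℝ) : ℝ) : ℂ) * g i (c - 1)

theorem ofReal_sqrt_ne_zero {x : ℝ} (hx : 0 < x) : ((√x : ℝ) : ℂ) ≠ 0 := by
  rw [Complex.ofReal_ne_zero]
  exact (Real.sqrt_pos.2 hx).ne'

/-- A vector in the kernel of the polarization is determined by its entries in the first row. -/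
theorem eq_zero_of_polarization {a b : ℕ} (hab : a ≤ b) {g : ℕ → ℕ → ℂ}
    (hg : polarization a b *ᵥ (fun p => g p.1 p.2) = 0) (h0 : ∀ j, a ≤ j → j ≤ b → g 0 j = 0) :
    ∀ i ≤ a, ∀ j ≤ b, g i j = 0 := by
  have hrec : ∀ r < a, ∀ c < b + 2,
      ((√((a : ℝ) - (r : ℕ)) : ℝ) : ℂ) * (((√((b : ℝ) + 1 - (c : ℕ)) : ℝ) : ℂ) * g r c) +
      ((√((r : ℕ) + 1 : ℝ) : ℝ) : ℂ) * (((√((c : ℕ) : ℝ) : ℝ) : ℂ) * g (r + 1) (c - 1)) = 0 := by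
    intro r hr c hc
    have := congrFun hg (⟨r, hr⟩, ⟨c, hc⟩)
    rwa [polarization_mulVec_apply] at this
  have hsolve : ∀ r c, r < a → c ≤ b → ((√((r : ℕ) + 1 : ℝ) : ℝ) : ℂ) *
      (((√((c : ℕ) : ℝ) : ℝ) : ℂ) * g (r + 1) (c - 1)) = 0 → g r c = 0 := by
    intro r c hr hc h
    have h1 := hrec r hr c (by omega)
    rw [h, add_zero, mul_eq_zero, mul_eq_zero] at h1
    have hr' : (r : ℝ) < a := by exact_mod_cast hr
    have hc' : (c : ℝ) ≤ b := by exact_mod_cast hc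
    rcases h1 with h1 | h1 | h1
    · exact absurd h1 (ofReal_sqrt_ne_zero (by linarith))
    · exact absurd h1 (ofReal_sqrt_ne_zero (by linarith))
    · exact h1
  -- The recursion links neighbours on an antidiagonal. An antidiagonal with `i + c < a` reaches
  -- column `0`, where the second term vanishes, and zeros propagate back from there.
  have hlow : ∀ c i, i + c < a → g i c = 0 := by
    intro c
    induction c with
    | zero =>
      intro i hi
      exact hsolve i 0 (by omega) (by omega) (by simp)
    | succ c ih =>
      intro i hi
      apply hsolve i (c + 1) (by omega) (by omega)
      rw [Nat.add_sub_cancel, ih (i + 1) (by omega), mul_zero, mul_zero]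
  intro i
  induction i with
  | zero =>
    intro _ j hj
    by_cases hja : a ≤ j
    · exact h0 j hja hj
    · exact hlow j 0 (by omega)
  | succ i ih =>
    intro hi j hj
    have h1 := hrec i (by omega) (j + 1) (by omega)
    have h2 : ((√((b : ℝ) + 1 - ((j + 1 : ℕ) : ℝ)) : ℝ) : ℂ) * g i (j + 1) = 0 := by
      by_cases hjb : j + 1 ≤ b
      · rw [ih (by omega) _ hjb, mul_zero]
      · have : j = b := by omega
        rw [this]
        simp
    rw [h2, mul_zero, zero_add, Nat.add_sub_cancel, mul_eq_zero, mul_eq_zero] at h1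
    rcases h1 with h1 | h1 | h1
    · exact absurd h1 (ofReal_sqrt_ne_zero (by positivity))
    · exact absurd h1 (ofReal_sqrt_ne_zero (by positivity))
    · exact h1

/-- The entries of an orthogonal family of vectors of minimal total spin. -/
def minSpinCoeff (a b m i j : ℕ) : ℝ := (-1) ^ i * krausCoeff b (b - a) m j (a - i)

/-- On the antidiagonal `r + c = a + m` the alternating sign makes the terms cancel, once their
radicands are equated by the absorption identities `e1` and `e2`. Elsewhere both terms vanish. -/
theorem minSpinCoeff_rec {a b m r c : ℕ} (hab : a ≤ b) (hm : m ≤ b - a) (hr : r < a)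
    (hc : c ≤ b + 1) :
    √((a : ℝ) - r) * (√((b : ℝ) + 1 - c) * minSpinCoeff a b m r c) +
      √((r : ℝ) + 1) * (√(c : ℝ) * minSpinCoeff a b m (r + 1) (c - 1)) = 0 := by
  rcases Nat.eq_zero_or_pos c with rfl | hc0
  · rw [minSpinCoeff, krausCoeff, if_neg (by omega)]
    simp
  by_cases hcb : c = b + 1
  · rw [minSpinCoeff, minSpinCoeff, krausCoeff, krausCoeff, hcb,
      if_neg (show ¬ b + 1 - 1 = a - (r + 1) + m by omega)]
    simp
  by_cases h : c = a - r + m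
  · rw [minSpinCoeff, minSpinCoeff, krausCoeff, krausCoeff, if_pos h, if_pos (by omega)]
    have hr' : (r : ℝ) < a := by exact_mod_cast hr
    have hc' : (c : ℝ) ≤ b := by exact_mod_cast (show c ≤ b by omega)
    have e1 : c.choose m * (a - r) = c * (c - 1).choose m := by
      obtain ⟨d, rfl⟩ : ∃ d, c = d + 1 := ⟨c - 1, by omega⟩
      have h1 := Nat.choose_mul_succ_eq d m
      rw [Nat.add_sub_cancel, mul_comm (d + 1), h1]
      congr 1
      omega
    have e2 : (b - (c - 1)).choose (b - a - m) * (r + 1) =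
        (b + 1 - c) * (b - c).choose (b - a - m) := by
      have h1 := Nat.choose_mul_succ_eq (b - c) (b - a - m)
      have h2 : b - (c - 1) = b - c + 1 := by omega
      rw [h2, show b + 1 - c = b - c + 1 by omega, mul_comm (b - c + 1), h1]
      congr 1
      omega
    have e1' : (c.choose m * (a - r) : ℝ) = c * (c - 1).choose m := by
      rw [← Nat.cast_sub hr.le]
      exact_mod_cast e1
    have e2' : ((b - (c - 1)).choose (b - a - m) * (r + 1) : ℝ) =
        (b + 1 - c) * (b - c).choose (b - a - m) := by
      rw [show ((b : ℝ) + 1 - c) = ((b + 1 - c : ℕ) : ℝ) by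
        rw [Nat.cast_sub (by omega)]; push_cast; ring]
      exact_mod_cast e2
    have key : √((a : ℝ) - r) * (√((b : ℝ) + 1 - c) *
          √(c.choose m * (b - c).choose (b - a - m) : ℝ)) =
        √((r : ℝ) + 1) * (√(c : ℝ) *
          √((c - 1).choose m * (b - (c - 1)).choose (b - a - m) : ℝ)) := by
      rw [← Real.sqrt_mul (by linarith), ← Real.sqrt_mul (by linarith),
        ← Real.sqrt_mul (by positivity), ← Real.sqrt_mul (by positivity)]
      congr 1
      linear_combination ((b : ℝ) + 1 - c) * (b - c).choose (b - a - m) * e1' -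
        c * (c - 1).choose m * e2'
    rw [pow_succ]
    linear_combination (-1) ^ r * key
  · rw [minSpinCoeff, minSpinCoeff, krausCoeff, krausCoeff, if_neg h,
      if_neg (show ¬ c - 1 = a - (r + 1) + m by omega)]
    simp

/-- The matrix whose columns are orthogonal vectors of minimal total spin. -/
def minSpinCols (a b : ℕ) : Matrix (Fin (a + 1) × Fin (b + 1)) (Fin (b - a + 1)) ℂ :=
  Matrix.of fun p m => (minSpinCoeff a b m p.1 p.2 : ℂ)

theorem polarization_mul_minSpinCols {a b : ℕ} (hab : a ≤ b) :
    polarization a b * minSpinCols a b = 0 := by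
  ext ⟨r, c⟩ m
  have h := polarization_mulVec_apply (fun i j => (minSpinCoeff a b m i j : ℂ)) r c
  have h1 := minSpinCoeff_rec hab (Nat.lt_succ_iff.1 m.2) r.2 (Nat.lt_succ_iff.1 c.2)
  have h2 : (polarization a b * minSpinCols a b) (r, c) m =
      (polarization a b *ᵥ fun p => (minSpinCoeff a b m p.1 p.2 : ℂ)) (r, c) := rfl
  rw [h2, h, Matrix.zero_apply]
  exact_mod_cast h1

theorem sum_krausCoeff_mul_self {a b m m' x : ℕ} (hab : a ≤ b) (hm : m ≤ b - a) (hx : x ≤ a) :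
    ∑ j ∈ range (b + 1), krausCoeff b (b - a) m j x * krausCoeff b (b - a) m' j x =
      if m = m' then ((m + x).choose x * (b - a - m + (a - x)).choose (a - x) : ℝ) else 0 := by
  split_ifs with h
  · subst h
    rw [sum_eq_single (x + m)]
    · rw [krausCoeff, if_pos rfl, Real.mul_self_sqrt (by positivity)]
      have e1 : (x + m).choose m = (m + x).choose x := by
        rw [add_comm m x, Nat.choose_symm_add]
      have e2 : (b - (x + m)).choose (b - a - m) = (b - a - m + (a - x)).choose (a - x) := by
        rw [show b - (x + m) = b - a - m + (a - x) by omega, Nat.choose_symm_add]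
      rw [e1, e2]
    · intro j _ hj
      rw [krausCoeff, if_neg hj, zero_mul]
    · intro hj
      rw [mem_range] at hj
      omega
  · refine sum_eq_zero fun j _ => ?_
    by_cases hj : j = x + m
    · rw [krausCoeff, krausCoeff, if_neg (show ¬ j = x + m' by omega), mul_zero]
    · rw [krausCoeff, if_neg hj, zero_mul]

/-- Columns with different `m` live on different antidiagonals, and the convolution identity gives
all of them the same norm. -/
theorem minSpinCols_gram {a b : ℕ} (hab : a ≤ b) :
    (minSpinCols a b)ᴴ * minSpinCols a b = ((b + 1).choose a : ℂ) • 1 := by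
  ext m m'
  have hm := Nat.lt_succ_iff.1 m.2
  have h1 : ((minSpinCols a b)ᴴ * minSpinCols a b) m m' =
      ((∑ i ∈ range (a + 1), ∑ j ∈ range (b + 1),
        minSpinCoeff a b m i j * minSpinCoeff a b m' i j : ℝ) : ℂ) := by
    rw [Matrix.mul_apply, Fintype.sum_prod_type, ← Fin.sum_univ_eq_sum_range
      (fun i => ∑ j ∈ range (b + 1), minSpinCoeff a b m i j * minSpinCoeff a b m' i j),
      Complex.ofReal_sum]
    refine sum_congr rfl fun i _ => ?_
    rw [← Fin.sum_univ_eq_sum_range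
      (fun j => minSpinCoeff a b m i j * minSpinCoeff a b m' i j), Complex.ofReal_sum]
    refine sum_congr rfl fun j _ => ?_
    simp [minSpinCols, conjTranspose_apply]
  have h2 : ∀ i ∈ range (a + 1), ∑ j ∈ range (b + 1),
      minSpinCoeff a b m i j * minSpinCoeff a b m' i j =
      if (m : ℕ) = m' then
        (((m : ℕ) + (a - i)).choose (a - i) * (b - a - m + (a - (a - i))).choose (a - (a - i)) : ℝ)
      else 0 := by
    intro i hi
    rw [← sum_krausCoeff_mul_self hab hm (Nat.sub_le a i)]
    refine sum_congr rfl fun j _ => ?_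
    have : ((-1 : ℝ) ^ i) * (-1) ^ i = 1 := by rw [← mul_pow]; simp
    rw [minSpinCoeff, minSpinCoeff]
    linear_combination krausCoeff b (b - a) m j (a - i) * krausCoeff b (b - a) m' j (a - i) * this
  rw [h1, sum_congr rfl h2, Matrix.smul_apply, Matrix.one_apply]
  by_cases h : m = m'
  · subst h
    simp only [if_true]
    have h3 := sum_multichoose_convolution m (b - a - m) a
    rw [← sum_range_reflect, show (m : ℕ) + (b - a - m) + 1 + a = b + 1 by omega] at h3
    rw [smul_eq_mul, mul_one, ← h3]
    push_cast
    refine sum_congr rfl fun i hi => ?_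
    simp
  · have h' : ¬ (m : ℕ) = m' := fun e => h (Fin.ext e)
    simp only [if_neg h', if_neg h]
    simp

theorem isEigenProj_minSpin {a b : ℕ} (hab : a ≤ b) :
    IsEigenProj (totalSpinSq a b) ((minSpin a b * (minSpin a b + 1) : ℝ) : ℂ)
      (((b + 1).choose a : ℂ)⁻¹ • (minSpinCols a b * (minSpinCols a b)ᴴ)) := by
  have hN : ((b + 1).choose a : ℂ) ≠ 0 := by
    exact_mod_cast (Nat.choose_pos (by omega)).ne'
  have hC : totalSpinSq a b = (polarization a b)ᴴ * polarization a b +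
      ((minSpin a b * (minSpin a b + 1) : ℝ) : ℂ) • 1 := by
    rw [conjTranspose_mul_polarization hab, sub_add_cancel]
  set μ := ((minSpin a b * (minSpin a b + 1) : ℝ) : ℂ)
  refine ⟨?_, ?_, ?_⟩
  · rw [Matrix.IsHermitian, conjTranspose_smul, conjTranspose_mul, conjTranspose_conjTranspose]
    simp
  · have h1 : totalSpinSq a b * minSpinCols a b = μ • minSpinCols a b := by
      rw [hC, Matrix.add_mul, Matrix.mul_assoc, polarization_mul_minSpinCols hab, Matrix.mul_zero,
        zero_add, Matrix.smul_mul, Matrix.one_mul]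
    rw [Matrix.mul_smul, ← Matrix.mul_assoc, h1, Matrix.smul_mul, smul_comm]
  · intro v hv
    have h1 : polarization a b *ᵥ v = 0 := by
      rw [hC, add_mulVec, smul_mulVec, one_mulVec, add_eq_right] at hv
      have h2 : star (polarization a b *ᵥ v) ⬝ᵥ (polarization a b *ᵥ v) = 0 := by
        rw [star_mulVec, ← dotProduct_mulVec, mulVec_mulVec, hv, dotProduct_zero]
      exact dotProduct_star_self_eq_zero.1 h2
    set V : ℕ → ℕ → ℂ := fun i j => if h : i < a + 1 ∧ j < b + 1 then v (⟨i, h.1⟩, ⟨j, h.2⟩) else 0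
      with hV
    have hvV : v = fun p => V p.1 p.2 := by
      ext p
      rw [hV]
      simp only
      rw [dif_pos ⟨p.1.2, p.2.2⟩]
    -- In row `0`, column `m` of `minSpinCols` has its only nonzero entry at `a + m`, so these
    -- coefficients match `v` on the entries that determine a kernel vector.
    set c : Fin (b - a + 1) → ℂ := fun m => V 0 (a + m) / minSpinCoeff a b m 0 (a + m) with hc
    set g : ℕ → ℕ → ℂ := fun i j => V i j - ∑ m : Fin (b - a + 1),
      (minSpinCoeff a b m i j : ℂ) * c m with hg
    have hgv : (fun p : Fin (a + 1) × Fin (b + 1) => g p.1 p.2) = v - minSpinCols a b *ᵥ c := by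
      ext p
      rw [hg, Pi.sub_apply, hvV]
      rfl
    have hg1 : polarization a b *ᵥ (fun p => g p.1 p.2) = 0 := by
      rw [hgv, mulVec_sub, h1, mulVec_mulVec, polarization_mul_minSpinCols hab, zero_mulVec,
        sub_zero]
    have hg0 : ∀ j, a ≤ j → j ≤ b → g 0 j = 0 := by
      intro j hja hjb
      have h2 : ∑ m : Fin (b - a + 1), (minSpinCoeff a b m 0 j : ℂ) * c m = V 0 j := by
        rw [sum_eq_single (⟨j - a, by omega⟩ : Fin (b - a + 1))]
        · simp only [hc]
          rw [show a + (j - a) = j by omega, mul_div_cancel₀]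
          rw [minSpinCoeff, krausCoeff, if_pos (by omega), Complex.ofReal_ne_zero, pow_zero,
            one_mul, Real.sqrt_ne_zero (by positivity)]
          have h3 := (Nat.choose_pos (show j - a ≤ j by omega)).ne'
          have h4 := (Nat.choose_pos (show b - a - (j - a) ≤ b - j by omega)).ne'
          exact_mod_cast mul_ne_zero h3 h4
        · intro m _ hm
          rw [minSpinCoeff, krausCoeff, if_neg]
          · simp
          · intro h
            apply hm
            ext
            simp only
            omega
        · simp
      rw [hg]
      simp only
      rw [h2, sub_self]
    have hzero := eq_zero_of_polarization hab hg1 hg0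
    have hvc : v = minSpinCols a b *ᵥ c := by
      rw [← sub_eq_zero, ← hgv]
      ext p
      exact hzero _ (Nat.lt_succ_iff.1 p.1.2) _ (Nat.lt_succ_iff.1 p.2.2)
    rw [hvc, mulVec_mulVec, Matrix.smul_mul, Matrix.mul_assoc, minSpinCols_gram hab,
      Matrix.mul_smul, Matrix.mul_one, smul_smul, inv_mul_cancel₀ hN, one_smul]

end

section

open Finset Matrix Real

/-! ### The channel in terms of Kraus operators -/

/-- The time reversal of an operator, which maps the spin operators to their negatives. -/
def reversal {a : ℕ} (ρ : Matrix (Fin (a + 1)) (Fin (a + 1)) ℂ) :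
    Matrix (Fin (a + 1)) (Fin (a + 1)) ℂ :=
  Matrix.of fun x y => (-1) ^ ((x : ℕ) + y) * ρ (Fin.rev y) (Fin.rev x)

theorem neg_one_pow_rev {a : ℕ} (x y : Fin (a + 1)) :
    (-1 : ℂ) ^ ((Fin.rev x : ℕ) + Fin.rev y) = (-1) ^ ((x : ℕ) + y) := by
  apply neg_one_pow_congr
  rw [Fin.val_rev, Fin.val_rev, Nat.even_iff, Nat.even_iff]
  omega

theorem posSemidef_reversal {a : ℕ} {ρ : Matrix (Fin (a + 1)) (Fin (a + 1)) ℂ}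
    (h : ρ.PosSemidef) : (reversal ρ).PosSemidef := by
  have h1 : reversal ρ = diagonal (fun x : Fin (a + 1) => (-1 : ℂ) ^ (x : ℕ)) *
      (ρᵀ.submatrix Fin.rev Fin.rev) *
      (diagonal (fun x : Fin (a + 1) => (-1 : ℂ) ^ (x : ℕ)))ᴴ := by
    ext x y
    rw [diagonal_conjTranspose, mul_diagonal, diagonal_mul]
    simp [reversal, pow_add]
    ring
  rw [h1]
  exact (h.transpose.submatrix _).mul_mul_conjTranspose_same _

theorem trace_reversal {a : ℕ} (ρ : Matrix (Fin (a + 1)) (Fin (a + 1)) ℂ) :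
    (reversal ρ).trace = ρ.trace := by
  rw [trace, trace, ← Equiv.sum_comp Fin.revPerm]
  refine sum_congr rfl fun x _ => ?_
  simp [reversal, ← two_mul, pow_mul]

theorem minSpin_comm (a b : ℕ) : minSpin a b = minSpin b a := abs_sub_comm _ _

theorem minSpin_of_le {a b : ℕ} (hab : a ≤ b) : minSpin a b = ((b : ℝ) - a) / 2 := by
  have : (a : ℝ) ≤ b := by exact_mod_cast hab
  rw [minSpin, abs_of_nonneg (by linarith)]
  ring

theorem channel_apply (a b : ℕ) (ρ : Matrix (Fin (a + 1)) (Fin (a + 1)) ℂ) (k l : Fin (b + 1)) :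
    channel a b ρ k l = ((((a : ℝ) + 1) / (2 * minSpin a b + 1) : ℝ) : ℂ) *
      ∑ j, ∑ i, projMinus a b (j, k) (i, l) * ρ i j := by
  rw [channel, Matrix.smul_apply, smul_eq_mul]
  congr 1
  rw [partialTraceLeft, of_apply]
  refine sum_congr rfl fun j _ => ?_
  rw [Matrix.mul_apply, Fintype.sum_prod_type]
  refine sum_congr rfl fun i _ => ?_
  rw [sum_eq_single l]
  · simp
  · intro l' _ hl
    simp [Matrix.one_apply_ne hl]
  · simp

theorem minSpinCols_mul_apply {a b : ℕ} (p q : Fin (a + 1) × Fin (b + 1)) :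
    (minSpinCols a b * (minSpinCols a b)ᴴ) p q = ∑ m ∈ range (b - a + 1),
      ((minSpinCoeff a b m p.1 p.2 * minSpinCoeff a b m q.1 q.2 : ℝ) : ℂ) := by
  rw [Matrix.mul_apply, ← Fin.sum_univ_eq_sum_range
    (fun m => ((minSpinCoeff a b m p.1 p.2 * minSpinCoeff a b m q.1 q.2 : ℝ) : ℂ))]
  refine sum_congr rfl fun m _ => ?_
  simp [minSpinCols, conjTranspose_apply]

theorem minSpinCoeff_eq (a b m : ℕ) (i : Fin (a + 1)) (j : Fin (b + 1)) :
    (minSpinCoeff a b m i j : ℂ) = (-1) ^ (i : ℕ) * krausOp a b m j (Fin.rev i) := by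
  rw [krausOp_apply, minSpinCoeff, Fin.val_rev]
  push_cast
  simp

/-- The entries of the minimal spin vectors are those of the Kraus operators with the first index
reversed and a sign (`minSpinCoeff_eq`). The partial trace thus becomes the Kraus sum on the time
reversed input. -/
theorem channel_of_le {a b : ℕ} (hab : a ≤ b) (ρ : Matrix (Fin (a + 1)) (Fin (a + 1)) ℂ) :
    channel a b ρ = ((b + 1).choose (b - a) : ℂ)⁻¹ • amplify a b (reversal ρ) := by
  have hconst : ((((a : ℝ) + 1) / (2 * minSpin a b + 1) : ℝ) : ℂ) * ((b + 1).choose a : ℂ)⁻¹ =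
      ((b + 1).choose (b - a) : ℂ)⁻¹ := by
    have h1 := Nat.choose_succ_right_eq (b + 1) a
    have h2 : (b + 1).choose (a + 1) = (b + 1).choose (b - a) :=
      Nat.choose_symm_of_eq_add (by omega)
    rw [h2] at h1
    have h3 : ((b + 1).choose (b - a) : ℂ) * (a + 1) = (b + 1).choose a * (b - a + 1) := by
      have h4 : b + 1 - a = b - a + 1 := by omega
      rw [h4] at h1
      rw [← Nat.cast_sub hab]
      exact_mod_cast h1
    have hN : ((b + 1).choose a : ℂ) ≠ 0 := by exact_mod_cast (Nat.choose_pos (by omega)).ne'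
    have hN' : ((b + 1).choose (b - a) : ℂ) ≠ 0 := by
      exact_mod_cast (Nat.choose_pos (by omega)).ne'
    have hba : (b : ℂ) - a + 1 ≠ 0 := by
      rw [← Nat.cast_sub hab]
      exact_mod_cast (b - a).succ_ne_zero
    rw [minSpin_of_le hab, show 2 * (((b : ℝ) - a) / 2) + 1 = b - a + 1 by ring]
    push_cast
    field_simp
    linear_combination h3
  ext k l
  rw [channel_apply, projMinus, (isEigenProj_minSpin hab).eigenProj_eq, Matrix.smul_apply,
    ← hconst, smul_eq_mul, mul_assoc]
  congr 1
  simp only [Matrix.smul_apply, smul_eq_mul, mul_assoc, ← mul_sum]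
  congr 1
  have h1 : ∀ m, (krausOp a b m * reversal ρ * (krausOp a b m)ᴴ) k l =
      ∑ j : Fin (a + 1), ∑ i : Fin (a + 1),
        ((minSpinCoeff a b m j k * minSpinCoeff a b m i l : ℝ) : ℂ) * ρ i j := by
    intro m
    simp only [Matrix.mul_apply, sum_mul]
    rw [sum_comm, ← Equiv.sum_comp Fin.revPerm]
    refine sum_congr rfl fun j _ => ?_
    rw [← Equiv.sum_comp Fin.revPerm]
    refine sum_congr rfl fun i _ => ?_
    rw [Complex.ofReal_mul, minSpinCoeff_eq, minSpinCoeff_eq, star_krausOp_apply, ← krausOp_apply,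
      Fin.revPerm_apply, Fin.revPerm_apply, reversal, of_apply, Fin.rev_rev, Fin.rev_rev,
      neg_one_pow_rev, pow_add]
    ring
  rw [amplify, Matrix.sum_apply, sum_congr rfl fun m _ => h1 m, sum_comm (s := range (b - a + 1))]
  refine sum_congr rfl fun j _ => ?_
  rw [sum_comm (s := range (b - a + 1))]
  refine sum_congr rfl fun i _ => ?_
  rw [minSpinCols_mul_apply, sum_mul]

theorem totalSpinSq_swap (a b : ℕ) :
    totalSpinSq a b = (totalSpinSq b a).submatrix Prod.swap Prod.swap := by
  have h1 : ∀ (S : Matrix (Fin (a + 1)) (Fin (a + 1)) ℂ) (T : Matrix (Fin (b + 1)) (Fin (b + 1)) ℂ),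
      totalSpin S T = (totalSpin T S).submatrix (Equiv.prodComm _ _) (Equiv.prodComm _ _) := by
    intro S T
    ext ⟨i, j⟩ ⟨k, l⟩
    simp [totalSpin, mul_comm, add_comm]
  rw [totalSpinSq, h1, h1, h1, totalSpinSq]
  simp only [sq, submatrix_mul_equiv]
  rfl

/-- After exchanging the tensor factors the same minimal spin vectors appear, now with the reversed
index on the output side, so the adjoint Kraus operators act. -/
theorem channel_of_ge {a b : ℕ} (hab : b ≤ a) (ρ : Matrix (Fin (a + 1)) (Fin (a + 1)) ℂ) :
    channel a b ρ = (a.choose b : ℂ)⁻¹ • reversal (reduce b a ρ) := by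
  have hconst : ((((a : ℝ) + 1) / (2 * minSpin a b + 1) : ℝ) : ℂ) * ((a + 1).choose b : ℂ)⁻¹ =
      (a.choose b : ℂ)⁻¹ := by
    have h1 := Nat.choose_mul_succ_eq a b
    have h3 : (a.choose b : ℂ) * (a + 1) = (a + 1).choose b * (a - b + 1) := by
      have h4 : a + 1 - b = a - b + 1 := by omega
      rw [h4] at h1
      rw [← Nat.cast_sub hab]
      exact_mod_cast h1
    have hN : ((a + 1).choose b : ℂ) ≠ 0 := by exact_mod_cast (Nat.choose_pos (by omega)).ne'
    have hN' : (a.choose b : ℂ) ≠ 0 := by exact_mod_cast (Nat.choose_pos hab).ne'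
    have hba : (a : ℂ) - b + 1 ≠ 0 := by
      rw [← Nat.cast_sub hab]
      exact_mod_cast (a - b).succ_ne_zero
    rw [minSpin_comm, minSpin_of_le hab, show 2 * (((a : ℝ) - b) / 2) + 1 = a - b + 1 by ring]
    push_cast
    field_simp
    linear_combination h3
  have hproj : projMinus a b = (((a + 1).choose b : ℂ)⁻¹ •
      (minSpinCols b a * (minSpinCols b a)ᴴ)).submatrix Prod.swap Prod.swap := by
    rw [projMinus, totalSpinSq_swap, minSpin_comm]
    exact ((isEigenProj_minSpin hab).submatrix (Equiv.prodComm _ _)).eigenProj_eq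
  ext k l
  rw [channel_apply, hproj, Matrix.smul_apply, ← hconst, smul_eq_mul, mul_assoc]
  congr 1
  simp only [submatrix_apply, Matrix.smul_apply, smul_eq_mul, mul_assoc, ← mul_sum]
  congr 1
  have h1 : ∀ m, (-1) ^ ((k : ℕ) + l) *
      ((krausOp b a m)ᴴ * ρ * krausOp b a m) (Fin.rev l) (Fin.rev k) =
      ∑ j : Fin (a + 1), ∑ i : Fin (a + 1),
        ((minSpinCoeff b a m k j * minSpinCoeff b a m l i : ℝ) : ℂ) * ρ i j := by
    intro m
    simp only [Matrix.mul_apply, sum_mul, mul_sum]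
    refine sum_congr rfl fun j _ => sum_congr rfl fun i _ => ?_
    rw [Complex.ofReal_mul, minSpinCoeff_eq, minSpinCoeff_eq, star_krausOp_apply, ← krausOp_apply,
      pow_add]
    ring
  rw [reversal, of_apply, reduce, Matrix.sum_apply, mul_sum, sum_congr rfl fun m _ => h1 m,
    sum_comm (s := range (a - b + 1))]
  refine sum_congr rfl fun j _ => ?_
  rw [sum_comm (s := range (a - b + 1))]
  refine sum_congr rfl fun i _ => ?_
  rw [minSpinCols_mul_apply, sum_mul]
  rfl

theorem isDensity_channel {a b : ℕ} {ρ : Matrix (Fin (a + 1)) (Fin (a + 1)) ℂ}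
    (h : IsDensity ρ) : IsDensity (channel a b ρ) := by
  have hinv : ∀ n : ℕ, (0 : ℂ) ≤ (n : ℂ)⁻¹ := fun n => by
    have : (0 : ℝ) ≤ (n : ℝ)⁻¹ := by positivity
    rw [← Complex.ofReal_natCast, ← Complex.ofReal_inv]
    exact Complex.zero_le_real.2 this
  rcases le_total a b with hab | hab
  · have hN : ((b + 1).choose (b - a) : ℂ) ≠ 0 := by
      exact_mod_cast (Nat.choose_pos (by omega)).ne'
    rw [channel_of_le hab]
    refine ⟨(posSemidef_amplify (posSemidef_reversal h.1)).smul (hinv _), ?_⟩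
    rw [trace_smul, trace_amplify hab, trace_reversal, h.2, smul_eq_mul, mul_one,
      inv_mul_cancel₀ hN]
  · have hN : (a.choose b : ℂ) ≠ 0 := by exact_mod_cast (Nat.choose_pos hab).ne'
    rw [channel_of_ge hab]
    refine ⟨(posSemidef_reversal (posSemidef_reduce h.1)).smul (hinv _), ?_⟩
    rw [trace_smul, trace_reversal, trace_reduce hab, h.2, smul_eq_mul, mul_one,
      inv_mul_cancel₀ hN]

end

section

open Finset Matrix Real

/-! ### Rotations -/

/-- Conjugation by `exp (t N)` rotates `Z` towards `X` if `[N, Z] = X` and `[N, X] = -Z`. -/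
theorem exp_mul_mul_exp_neg {𝔸 : Type*} [NormedRing 𝔸] [NormedAlgebra ℝ 𝔸] [CompleteSpace 𝔸]
    {N X Z : 𝔸} (hZ : N * Z = Z * N + X) (hX : N * X = X * N - Z) (t : ℝ) :
    NormedSpace.exp (t • N) * Z * NormedSpace.exp (t • (-N)) = cos t • Z + sin t • X := by
  let : NormedAlgebra ℚ 𝔸 := NormedAlgebra.restrictScalars ℚ ℝ 𝔸
  have hinv : ∀ t : ℝ, NormedSpace.exp (t • N) * NormedSpace.exp (t • (-N)) = 1 := by
    intro t
    rw [smul_neg, ← NormedSpace.exp_add_of_commute (Commute.refl (t • N)).neg_right,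
      add_neg_cancel, NormedSpace.exp_zero]
  -- Rotating the claimed right-hand side back gives a curve with zero derivative by the commutation
  -- relations, hence constantly `Z`.
  set G : ℝ → 𝔸 := fun t =>
    NormedSpace.exp (t • (-N)) * (cos t • Z + sin t • X) * NormedSpace.exp (t • N) with hG
  have hderiv : ∀ t, HasDerivAt G 0 t := by
    intro t
    have h1 := hasDerivAt_exp_smul_const (𝕂 := ℝ) (-N) t
    have h2 := hasDerivAt_exp_smul_const' (𝕂 := ℝ) N t
    have h3 : HasDerivAt (fun t : ℝ => cos t • Z + sin t • X) (-sin t • Z + cos t • X) t :=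
      ((hasDerivAt_cos t).smul_const Z).add ((hasDerivAt_sin t).smul_const X)
    have h5 : (NormedSpace.exp (t • (-N)) * -N * (cos t • Z + sin t • X) +
        NormedSpace.exp (t • (-N)) * (-sin t • Z + cos t • X)) * NormedSpace.exp (t • N) +
        NormedSpace.exp (t • (-N)) * (cos t • Z + sin t • X) * (N * NormedSpace.exp (t • N)) =
        0 := by
      have : -N * (cos t • Z + sin t • X) + (-sin t • Z + cos t • X) +
          (cos t • Z + sin t • X) * N = 0 := by
        simp only [mul_add, add_mul, mul_smul_comm, smul_mul_assoc, neg_mul, hZ, hX]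
        module
      rw [← mul_assoc _ N, ← add_mul, mul_assoc _ (-N), mul_assoc _ _ N, ← mul_add, ← mul_add,
        this, mul_zero, zero_mul]
    rw [← h5]
    exact (h1.mul h3).mul h2
  have hconst : G t = G 0 := by
    apply is_const_of_deriv_eq_zero (fun t => (hderiv t).differentiableAt)
    intro t
    exact (hderiv t).deriv
  have h0 : G 0 = Z := by simp [hG, NormedSpace.exp_zero]
  have h6 : NormedSpace.exp (t • (-N)) * (cos t • Z + sin t • X) * NormedSpace.exp (t • N) = Z :=
    hconst.trans h0
  calc NormedSpace.exp (t • N) * Z * NormedSpace.exp (t • (-N))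
      = NormedSpace.exp (t • N) * (NormedSpace.exp (t • (-N)) * (cos t • Z + sin t • X) *
          NormedSpace.exp (t • N)) * NormedSpace.exp (t • (-N)) := by rw [h6]
    _ = (NormedSpace.exp (t • N) * NormedSpace.exp (t • (-N))) * (cos t • Z + sin t • X) *
          (NormedSpace.exp (t • N) * NormedSpace.exp (t • (-N))) := by simp only [mul_assoc]
    _ = _ := by rw [hinv, one_mul, mul_one]

open scoped Matrix.Norms.Operator in
/-- A one-parameter group of unitaries rotating `Z` towards `X` and fixing `Y`, for Hermitian
matrices with the commutation relations of a spin. -/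
theorem exists_rotation {n : Type*} [Fintype n] [DecidableEq n] {X Y Z : Matrix n n ℂ}
    (hY : Y.IsHermitian) (hYZ : Y * Z = Z * Y + Complex.I • X)
    (hXY : X * Y = Y * X + Complex.I • Z) (t : ℝ) :
    ∃ U : Matrix n n ℂ, Uᴴ * U = 1 ∧ U * Z * Uᴴ = (cos t : ℂ) • Z + (sin t : ℂ) • X ∧
      U * X * Uᴴ = (cos t : ℂ) • X - (sin t : ℂ) • Z ∧ U * Y * Uᴴ = Y := by
  set N := (-Complex.I) • Y with hN
  have hNstar : (t • N)ᴴ = t • (-N) := by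
    rw [hN, conjTranspose_smul, conjTranspose_smul, hY]
    simp
  have hNZ : N * Z = Z * N + X := by
    rw [hN, Matrix.smul_mul, hYZ, Matrix.mul_smul, smul_add, smul_smul]
    simp
  have hNX : N * X = X * N - Z := by
    rw [hN, Matrix.smul_mul, Matrix.mul_smul, hXY, smul_add, smul_smul]
    simp
  have hNY : N * Y = Y * N + 0 := by
    rw [hN, Matrix.smul_mul, Matrix.mul_smul, add_zero]
  have hUstar : (NormedSpace.exp (t • N))ᴴ = NormedSpace.exp (t • (-N)) := by
    rw [← Matrix.exp_conjTranspose, hNstar]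
  have hU : (NormedSpace.exp (t • N))ᴴ * NormedSpace.exp (t • N) = 1 := by
    rw [hUstar, smul_neg, ← Matrix.exp_add_of_commute _ _ (Commute.refl (t • N)).neg_left,
      neg_add_cancel, NormedSpace.exp_zero]
  refine ⟨NormedSpace.exp (t • N), hU, ?_, ?_, ?_⟩
  · rw [hUstar]
    exact exp_mul_mul_exp_neg hNZ hNX t
  -- The pair `(X, -Z)` satisfies the same relations as `(Z, X)`.
  · have h := exp_mul_mul_exp_neg (X := -Z) (Z := X) (by rw [hNX, sub_eq_add_neg])
      (by rw [mul_neg, hNZ, neg_mul]; abel) t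
    rw [hUstar]
    refine h.trans ?_
    rw [smul_neg, ← sub_eq_add_neg]
    rfl
  · have hc : N * Y = Y * N := by rw [hNY, add_zero]
    have hcomm : Commute (NormedSpace.exp (t • N)) Y := by
      have h1 : Commute (t • N) Y := (show Commute N Y from hc).smul_left t
      exact h1.exp_left
    rw [hcomm.eq, Matrix.mul_assoc, mul_eq_one_comm.1 hU, Matrix.mul_one]

theorem conj_mul_conj {n : Type*} [Fintype n] [DecidableEq n] {W : Matrix n n ℂ}
    (hW : Wᴴ * W = 1) (A B : Matrix n n ℂ) :
    W * A * Wᴴ * (W * B * Wᴴ) = W * (A * B) * Wᴴ := by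
  calc W * A * Wᴴ * (W * B * Wᴴ) = W * A * (Wᴴ * W) * B * Wᴴ := by simp only [Matrix.mul_assoc]
    _ = _ := by rw [hW, Matrix.mul_one, Matrix.mul_assoc W A B]

theorem conj_sq_add_sq_add_sq {n : Type*} [Fintype n] [DecidableEq n] {W A B C : Matrix n n ℂ}
    (hW : Wᴴ * W = 1) {t : ℝ} (hA : W * A * Wᴴ = (cos t : ℂ) • A + (sin t : ℂ) • B)
    (hB : W * B * Wᴴ = (cos t : ℂ) • B - (sin t : ℂ) • A) (hC : W * C * Wᴴ = C) :
    W * (A ^ 2 + B ^ 2 + C ^ 2) * Wᴴ = A ^ 2 + B ^ 2 + C ^ 2 := by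
  have ht : (cos t : ℂ) ^ 2 + (sin t : ℂ) ^ 2 = 1 := by
    exact_mod_cast Real.cos_sq_add_sin_sq t
  rw [Matrix.mul_add, Matrix.mul_add, Matrix.add_mul, Matrix.add_mul, sq, sq, sq,
    ← conj_mul_conj hW, ← conj_mul_conj hW, ← conj_mul_conj hW, hA, hB, hC]
  simp only [Matrix.mul_add, Matrix.add_mul, Matrix.mul_sub, Matrix.sub_mul, Matrix.mul_smul,
    Matrix.smul_mul]
  linear_combination (norm := module) ht • (A * A + B * B)

theorem kronecker_conj_totalSpin {a b : ℕ} {U : Matrix (Fin (a + 1)) (Fin (a + 1)) ℂ}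
    {V : Matrix (Fin (b + 1)) (Fin (b + 1)) ℂ} (hU : Uᴴ * U = 1) (hV : Vᴴ * V = 1)
    (S : Matrix (Fin (a + 1)) (Fin (a + 1)) ℂ) (T : Matrix (Fin (b + 1)) (Fin (b + 1)) ℂ) :
    (U ⊗ₖ V) * totalSpin S T * (U ⊗ₖ V)ᴴ = totalSpin (U * S * Uᴴ) (V * T * Vᴴ) := by
  rw [totalSpin, Matrix.mul_add, Matrix.add_mul, conjTranspose_kronecker, ← mul_kronecker_mul,
    ← mul_kronecker_mul, ← mul_kronecker_mul, ← mul_kronecker_mul, Matrix.mul_one, Matrix.mul_one,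
    mul_eq_one_comm.1 hU, mul_eq_one_comm.1 hV]
  rfl

theorem kronecker_unitary {a b : ℕ} {U : Matrix (Fin (a + 1)) (Fin (a + 1)) ℂ}
    {V : Matrix (Fin (b + 1)) (Fin (b + 1)) ℂ} (hU : Uᴴ * U = 1) (hV : Vᴴ * V = 1) :
    (U ⊗ₖ V)ᴴ * (U ⊗ₖ V) = 1 := by
  rw [conjTranspose_kronecker, ← mul_kronecker_mul, hU, hV, one_kronecker_one]

theorem totalSpin_linear {a b : ℕ} (c s : ℂ) (S S' : Matrix (Fin (a + 1)) (Fin (a + 1)) ℂ)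
    (T T' : Matrix (Fin (b + 1)) (Fin (b + 1)) ℂ) :
    totalSpin (c • S + s • S') (c • T + s • T') = c • totalSpin S T + s • totalSpin S' T' := by
  simp only [totalSpin, add_kronecker, kronecker_add, smul_kronecker, kronecker_smul]
  module

/-- A family of unitaries, one for each spin, which leaves every total spin invariant. -/
structure IsSpinRotation (U : ∀ a : ℕ, Matrix (Fin (a + 1)) (Fin (a + 1)) ℂ) : Prop where
  unitary : ∀ a, (U a)ᴴ * U a = 1
  totalSpinSq_invariant : ∀ a b, (U a ⊗ₖ U b) * totalSpinSq a b * (U a ⊗ₖ U b)ᴴ = totalSpinSq a b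

theorem IsSpinRotation.mul {U V : ∀ a : ℕ, Matrix (Fin (a + 1)) (Fin (a + 1)) ℂ}
    (hU : IsSpinRotation U) (hV : IsSpinRotation V) : IsSpinRotation fun a => U a * V a := by
  refine ⟨fun a => ?_, fun a b => ?_⟩
  · rw [conjTranspose_mul, Matrix.mul_assoc, ← Matrix.mul_assoc (U a)ᴴ, hU.unitary, Matrix.one_mul,
      hV.unitary]
  · rw [mul_kronecker_mul, conjTranspose_mul]
    calc _ = (U a ⊗ₖ U b) * ((V a ⊗ₖ V b) * totalSpinSq a b * (V a ⊗ₖ V b)ᴴ) * (U a ⊗ₖ U b)ᴴ := by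
          simp only [Matrix.mul_assoc]
      _ = _ := by rw [hV.totalSpinSq_invariant, hU.totalSpinSq_invariant]

theorem isSpinRotation_of_components {U : ∀ a : ℕ, Matrix (Fin (a + 1)) (Fin (a + 1)) ℂ}
    {A B C : ∀ a : ℕ, Matrix (Fin (a + 1)) (Fin (a + 1)) ℂ} {t : ℝ}
    (hU : ∀ a, (U a)ᴴ * U a = 1 ∧ U a * A a * (U a)ᴴ = (cos t : ℂ) • A a + (sin t : ℂ) • B a ∧
      U a * B a * (U a)ᴴ = (cos t : ℂ) • B a - (sin t : ℂ) • A a ∧ U a * C a * (U a)ᴴ = C a)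
    (htot : ∀ a b, totalSpinSq a b = totalSpin (A a) (A b) ^ 2 + totalSpin (B a) (B b) ^ 2 +
      totalSpin (C a) (C b) ^ 2) : IsSpinRotation U := by
  refine ⟨fun a => (hU a).1, fun a b => ?_⟩
  obtain ⟨h1, hA, hB, hC⟩ := hU a
  obtain ⟨h1', hA', hB', hC'⟩ := hU b
  rw [htot]
  refine conj_sq_add_sq_add_sq (t := t) (kronecker_unitary h1 h1') ?_ ?_ ?_ <;>
    rw [kronecker_conj_totalSpin h1 h1']
  · rw [hA, hA', totalSpin_linear]
  · rw [hB, hB', sub_eq_add_neg, sub_eq_add_neg, ← neg_smul, ← neg_smul, totalSpin_linear,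
      neg_smul, ← sub_eq_add_neg]
  · rw [hC, hC']

/-! ### Commutation relations of the Cartesian components -/

theorem conjTranspose_spinMinus (a : ℕ) : (spinMinus a)ᴴ = spinPlus a :=
  conjTranspose_conjTranspose _

theorem isHermitian_spinY (a : ℕ) : (spinY a).IsHermitian := by
  rw [Matrix.IsHermitian, spinY_eq, conjTranspose_smul, conjTranspose_sub, conjTranspose_spinMinus,
    ← spinMinus]
  simp
  module

theorem isHermitian_spinZ (a : ℕ) : (spinZ a).IsHermitian := by
  rw [spinZ, isHermitian_diagonal_iff]
  intro i
  simp [isSelfAdjoint_iff]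

theorem spinY_mul_spinZ (a : ℕ) :
    spinY a * spinZ a = spinZ a * spinY a + Complex.I • spinX a := by
  rw [spinY_eq, spinX, Matrix.smul_mul, Matrix.mul_smul, Matrix.sub_mul, Matrix.mul_sub,
    spinZ_mul_spinPlus, spinZ_mul_spinMinus]
  module

theorem spinZ_mul_spinX (a : ℕ) :
    spinZ a * spinX a = spinX a * spinZ a + Complex.I • spinY a := by
  rw [spinY_eq, spinX, Matrix.smul_mul, Matrix.mul_smul, Matrix.add_mul, Matrix.mul_add,
    spinZ_mul_spinPlus, spinZ_mul_spinMinus, smul_smul,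
    show Complex.I * -(Complex.I / 2) = 1 / 2 by linear_combination (-1 / 2) * Complex.I_mul_I]
  module

theorem spinX_mul_spinY (a : ℕ) :
    spinX a * spinY a = spinY a * spinX a + Complex.I • spinZ a := by
  rw [spinY_eq, spinX]
  simp only [Matrix.smul_mul, Matrix.mul_smul, Matrix.sub_mul, Matrix.mul_sub, Matrix.add_mul,
    Matrix.mul_add, spinPlus_mul_spinMinus]
  module

/-- The `z` axis can be rotated to any direction. -/
theorem exists_isSpinRotation (ω : Metric.sphere (0 : EuclideanSpace ℝ (Fin 3)) 1) :
    ∃ U : ∀ a : ℕ, Matrix (Fin (a + 1)) (Fin (a + 1)) ℂ, IsSpinRotation U ∧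
      ∀ a, U a * spinZ a * (U a)ᴴ = ((ω.1 0 : ℝ) : ℂ) • spinX a + ((ω.1 1 : ℝ) : ℂ) • spinY a +
        ((ω.1 2 : ℝ) : ℂ) • spinZ a := by
  have hω : ω.1 0 ^ 2 + ω.1 1 ^ 2 + ω.1 2 ^ 2 = 1 := by
    have h := mem_sphere_zero_iff_norm.1 ω.2
    rw [EuclideanSpace.norm_eq, Real.sqrt_eq_one] at h
    simpa [Fin.sum_univ_three] using h
  -- Spherical coordinates: a rotation about the `y` axis by the polar angle `arccos (ω.1 2)`, then
  -- one about the `z` axis by the azimuth `arg z`. The angles do not depend on the spin, so all `U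
  -- a` represent one rotation.
  set z : ℂ := ⟨ω.1 0, ω.1 1⟩ with hz
  have hcos : cos (arccos (ω.1 2)) = ω.1 2 :=
    cos_arccos (by nlinarith [sq_nonneg (ω.1 0), sq_nonneg (ω.1 1)])
      (by nlinarith [sq_nonneg (ω.1 0), sq_nonneg (ω.1 1)])
  have hsin : sin (arccos (ω.1 2)) = ‖z‖ := by
    rw [sin_arccos, Complex.norm_eq_sqrt_sq_add_sq]
    congr 1
    linarith
  have hx : ‖z‖ * cos (Complex.arg z) = ω.1 0 := Complex.norm_mul_cos_arg z
  have hy : ‖z‖ * sin (Complex.arg z) = ω.1 1 := Complex.norm_mul_sin_arg z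
  choose V hV using fun a =>
    exists_rotation (isHermitian_spinY a) (spinY_mul_spinZ a) (spinX_mul_spinY a) (arccos (ω.1 2))
  choose W hW using fun a =>
    exists_rotation (isHermitian_spinZ a) (spinZ_mul_spinX a) (spinY_mul_spinZ a) (Complex.arg z)
  refine ⟨fun a => W a * V a, IsSpinRotation.mul (isSpinRotation_of_components hW fun a b => rfl)
    (isSpinRotation_of_components hV fun a b => ?_), fun a => ?_⟩
  · rw [totalSpinSq]
    abel
  · have h : W a * V a * spinZ a * (W a * V a)ᴴ = W a * (V a * spinZ a * (V a)ᴴ) * (W a)ᴴ := by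
      simp only [conjTranspose_mul, Matrix.mul_assoc]
    rw [h, (hV a).2.1, hcos, hsin, Matrix.mul_add, Matrix.add_mul, Matrix.mul_smul, Matrix.smul_mul,
      Matrix.mul_smul, Matrix.smul_mul, (hW a).2.1, (hW a).2.2.2, ← hx, ← hy]
    push_cast
    module

end

section

open Finset Matrix Real

/-! ### Covariance -/

theorem isEigenProj_projMinus (a b : ℕ) : IsEigenProj (totalSpinSq a b)
    ((minSpin a b * (minSpin a b + 1) : ℝ) : ℂ) (projMinus a b) := by
  rcases le_total a b with hab | hab
  · have h := isEigenProj_minSpin hab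
    rwa [← h.eigenProj_eq] at h
  · have h := (isEigenProj_minSpin hab).submatrix (Equiv.prodComm (Fin (a + 1)) (Fin (b + 1)))
    have h1 : (totalSpinSq b a).submatrix (Equiv.prodComm (Fin (a + 1)) (Fin (b + 1)))
      (Equiv.prodComm _ _) = totalSpinSq a b := (totalSpinSq_swap a b).symm
    rw [h1, minSpin_comm] at h
    rwa [← h.eigenProj_eq] at h

/-- A spectral projection of an invariant operator is invariant. -/
theorem IsSpinRotation.conj_projMinus {U : ∀ a : ℕ, Matrix (Fin (a + 1)) (Fin (a + 1)) ℂ}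
    (hU : IsSpinRotation U) (a b : ℕ) :
    (U a ⊗ₖ U b) * projMinus a b * (U a ⊗ₖ U b)ᴴ = projMinus a b := by
  have h := (isEigenProj_projMinus a b).conj (kronecker_unitary (hU.unitary a) (hU.unitary b))
  rw [hU.totalSpinSq_invariant] at h
  exact h.eigenProj_eq.symm

theorem trace_partialTraceLeft_mul {m n : Type*} [Fintype m] [Fintype n] [DecidableEq m]
    (A : Matrix (m × n) (m × n) ℂ) (B : Matrix n n ℂ) :
    (partialTraceLeft A * B).trace = (A * ((1 : Matrix m m ℂ) ⊗ₖ B)).trace := by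
  have h1 : ∀ (i : m) (k : n), (A * ((1 : Matrix m m ℂ) ⊗ₖ B)) (i, k) (i, k) =
      ∑ l, A (i, k) (i, l) * B l k := by
    intro i k
    rw [Matrix.mul_apply, Fintype.sum_prod_type, sum_eq_single i]
    · simp
    · intro j _ hj
      simp [Matrix.one_apply_ne hj]
    · simp
  have h2 : ∀ k : n, (partialTraceLeft A * B) k k = ∑ i, ∑ l, A (i, k) (i, l) * B l k := by
    intro k
    rw [Matrix.mul_apply, sum_comm]
    refine sum_congr rfl fun l _ => ?_
    rw [partialTraceLeft, of_apply, sum_mul]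
  rw [trace, trace, Fintype.sum_prod_type, sum_comm]
  refine sum_congr rfl fun k _ => ?_
  rw [Matrix.diag_apply, h2]
  exact sum_congr rfl fun i _ => (h1 i k).symm

/-- The partial trace is dual to `B ↦ 1 ⊗ₖ B`, so the identity is tested by traces against `B`,
where `U` cancels cyclically. -/
theorem partialTraceLeft_conj {a b : ℕ} {U : Matrix (Fin (a + 1)) (Fin (a + 1)) ℂ}
    (hU : Uᴴ * U = 1) (V : Matrix (Fin (b + 1)) (Fin (b + 1)) ℂ)
    (A : Matrix (Fin (a + 1) × Fin (b + 1)) (Fin (a + 1) × Fin (b + 1)) ℂ) :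
    partialTraceLeft ((U ⊗ₖ V) * A * (U ⊗ₖ V)ᴴ) = V * partialTraceLeft A * Vᴴ := by
  rw [ext_iff_trace_mul_right]
  intro B
  rw [trace_partialTraceLeft_mul, Matrix.mul_assoc, Matrix.mul_assoc, trace_mul_comm,
    conjTranspose_kronecker, Matrix.mul_assoc, ← mul_kronecker_mul, ← mul_kronecker_mul,
    Matrix.mul_one, hU, ← trace_partialTraceLeft_mul, ← Matrix.mul_assoc, trace_mul_comm _ V]
  simp only [Matrix.mul_assoc]

theorem IsSpinRotation.channel_conj {U : ∀ a : ℕ, Matrix (Fin (a + 1)) (Fin (a + 1)) ℂ}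
    (hU : IsSpinRotation U) (a b : ℕ) (ρ : Matrix (Fin (a + 1)) (Fin (a + 1)) ℂ) :
    channel a b (U a * ρ * (U a)ᴴ) = U b * channel a b ρ * (U b)ᴴ := by
  have h1 : (U a * ρ * (U a)ᴴ) ⊗ₖ (1 : Matrix (Fin (b + 1)) (Fin (b + 1)) ℂ) =
      (U a ⊗ₖ U b) * (ρ ⊗ₖ (1 : Matrix (Fin (b + 1)) (Fin (b + 1)) ℂ)) * (U a ⊗ₖ U b)ᴴ := by
    rw [conjTranspose_kronecker, ← mul_kronecker_mul, ← mul_kronecker_mul, Matrix.mul_one,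
      mul_eq_one_comm.1 (hU.unitary b)]
  rw [channel, channel, h1]
  conv_lhs => rw [← hU.conj_projMinus]
  rw [conj_mul_conj (kronecker_unitary (hU.unitary a) (hU.unitary b)),
    partialTraceLeft_conj (hU.unitary a), Matrix.mul_smul, Matrix.smul_mul]

/-! ### Coherent states -/

/-- The projection onto the highest weight vector. -/
def highestWeightProj (a : ℕ) : Matrix (Fin (a + 1)) (Fin (a + 1)) ℂ :=
  diagonal fun i => if (i : ℕ) = 0 then 1 else 0

theorem isEigenProj_highestWeightProj (a : ℕ) :
    IsEigenProj (spinZ a) ((a : ℂ) / 2) (highestWeightProj a) := by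
  refine ⟨?_, ?_, ?_⟩
  · rw [highestWeightProj, isHermitian_diagonal_iff]
    intro i
    split_ifs <;> simp
  · rw [spinZ, highestWeightProj, diagonal_mul_diagonal, ← diagonal_smul]
    congr 1
    ext i
    simp only [Pi.smul_apply, smul_eq_mul]
    split_ifs with h
    · simp [h]
    · simp
  · intro v hv
    ext i
    have h := congrFun hv i
    rw [spinZ, mulVec_diagonal, Pi.smul_apply, smul_eq_mul] at h
    rw [highestWeightProj, mulVec_diagonal]
    split_ifs with hi
    · rw [one_mul]
    · have h1 : ((i : ℕ) : ℂ) * v i = 0 := by linear_combination -h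
      have h2 : v i = 0 := (mul_eq_zero.1 h1).resolve_left (by exact_mod_cast hi)
      rw [h2, mul_zero]

theorem isDensity_highestWeightProj (a : ℕ) : IsDensity (highestWeightProj a) := by
  refine ⟨?_, ?_⟩
  · refine PosSemidef.diagonal fun i => ?_
    simp only [Pi.zero_apply]
    split_ifs <;> simp
  · rw [highestWeightProj, trace_diagonal, sum_eq_single 0]
    · simp
    · intro i _ hi
      rw [if_neg (fun h : (i : ℕ) = 0 => hi (Fin.ext h))]
    · simp

theorem IsDensity.unitary_conj {n : Type*} [Fintype n] [DecidableEq n] {ρ U : Matrix n n ℂ}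
    (h : IsDensity ρ) (hU : Uᴴ * U = 1) : IsDensity (U * ρ * Uᴴ) := by
  refine ⟨h.1.mul_mul_conjTranspose_same U, ?_⟩
  rw [trace_mul_comm, ← Matrix.mul_assoc, hU, Matrix.one_mul, h.2]

theorem exists_coherentProj_eq (ω : Metric.sphere (0 : EuclideanSpace ℝ (Fin 3)) 1) :
    ∃ U : ∀ a : ℕ, Matrix (Fin (a + 1)) (Fin (a + 1)) ℂ, IsSpinRotation U ∧
      ∀ a, coherentProj a ω = U a * highestWeightProj a * (U a)ᴴ := by
  obtain ⟨U, hU, h⟩ := exists_isSpinRotation ω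
  refine ⟨U, hU, fun a => ?_⟩
  have h1 := (isEigenProj_highestWeightProj a).conj (hU.unitary a)
  rw [h] at h1
  exact h1.eigenProj_eq

theorem isDensity_coherentProj (a : ℕ) (ω : Metric.sphere (0 : EuclideanSpace ℝ (Fin 3)) 1) :
    IsDensity (coherentProj a ω) := by
  obtain ⟨U, hU, h⟩ := exists_coherentProj_eq ω
  rw [h]
  exact (isDensity_highestWeightProj a).unitary_conj (hU.unitary a)

/-- By covariance, rotating the input conjugates the output by a unitary and leaves its spectrum
unchanged. -/
theorem traceFun_channel_coherentProj (f : ℝ → ℝ) (a b : ℕ)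
    (ω : Metric.sphere (0 : EuclideanSpace ℝ (Fin 3)) 1) :
    traceFun f (channel a b (coherentProj a ω)) =
      traceFun f (channel a b (highestWeightProj a)) := by
  obtain ⟨U, hU, h⟩ := exists_coherentProj_eq ω
  rw [h, hU.channel_conj, traceFun_unitary_conj f
    (isDensity_channel (isDensity_highestWeightProj a)).1.isHermitian (hU.unitary b)]

theorem reversal_highestWeightProj (a : ℕ) : reversal (highestWeightProj a) =
    diagonal fun i : Fin (a + 1) => if (i : ℕ) = a then 1 else 0 := by
  ext x y
  rw [reversal, of_apply, highestWeightProj]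
  by_cases hxy : x = y
  · subst hxy
    have hx := x.2
    have h1 : (a - (x : ℕ) = 0) ↔ (x : ℕ) = a := by omega
    rw [diagonal_apply_eq, diagonal_apply_eq, Fin.val_rev, Nat.add_sub_add_right,
      if_congr h1 rfl rfl, ← two_mul, pow_mul]
    simp
  · rw [diagonal_apply_ne _ hxy, diagonal_apply_ne _ (fun h => hxy (Fin.rev_injective h).symm),
      mul_zero]

/-- Time reversal has turned the highest weight into the lowest. Only `m = p - a` contributes to the
entry `p`, with value `p.choose a`. -/
theorem amplify_lowestWeightProj {a b : ℕ} (hab : a ≤ b) :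
    amplify a b (diagonal fun i : Fin (a + 1) => if (i : ℕ) = a then 1 else 0) =
      diagonal fun p : Fin (b + 1) => (coherentWeight a b (b - p) : ℂ) := by
  have h1 : ∀ (m : ℕ) (p q : Fin (b + 1)), (krausOp a b m *
      (diagonal fun i : Fin (a + 1) => if (i : ℕ) = a then (1 : ℂ) else 0) * (krausOp a b m)ᴴ) p q =
      ((krausCoeff b (b - a) m p a * krausCoeff b (b - a) m q a : ℝ) : ℂ) := by
    intro m p q
    rw [Matrix.mul_apply, sum_eq_single (Fin.last a)]
    · rw [mul_diagonal, krausOp_apply, star_krausOp_apply]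
      simp
    · intro i _ hi
      rw [mul_diagonal, if_neg (fun h : (i : ℕ) = a => hi (Fin.ext h)), mul_zero, zero_mul]
    · simp
  ext p q
  rw [amplify, Matrix.sum_apply, sum_congr rfl fun m _ => h1 m p q]
  have hp := p.2
  by_cases hpq : p = q
  · subst hpq
    rw [diagonal_apply_eq, coherentWeight]
    split_ifs with h
    · rw [sum_eq_single ((p : ℕ) - a)]
      · rw [krausCoeff, if_pos (by omega), Real.mul_self_sqrt (by positivity),
          show b - a - ((p : ℕ) - a) = b - p by omega, Nat.choose_self,
          Nat.choose_symm (by omega), show b - (b - (p : ℕ)) = p by omega]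
        simp
      · intro m _ hm
        rw [krausCoeff, if_neg (by omega)]
        simp
      · intro hm
        rw [mem_range] at hm
        omega
    · rw [Complex.ofReal_zero]
      refine sum_eq_zero fun m _ => ?_
      rw [krausCoeff, if_neg (by omega)]
      simp
  · rw [diagonal_apply_ne _ hpq]
    refine sum_eq_zero fun m _ => ?_
    have hpq' : (p : ℕ) ≠ q := fun h => hpq (Fin.ext h)
    by_cases h : (p : ℕ) = a + m
    · rw [krausCoeff, krausCoeff, if_neg (show ¬ (q : ℕ) = a + m by omega)]
      simp
    · rw [krausCoeff, if_neg h]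
      simp

/-- All bosons occupy the first mode, so only `m = 0` can remove any; the result stays of rank one.
-/
theorem reduce_highestWeightProj (a b : ℕ) :
    reduce b a (highestWeightProj a) = (a.choose (a - b) : ℂ) • highestWeightProj b := by
  have h1 : ∀ (m : ℕ) (i j : Fin (b + 1)), ((krausOp b a m)ᴴ * highestWeightProj a *
      krausOp b a m) i j =
      ((krausCoeff a (a - b) m 0 i * krausCoeff a (a - b) m 0 j : ℝ) : ℂ) := by
    intro m i j
    rw [Matrix.mul_apply, sum_eq_single 0]
    · rw [highestWeightProj, mul_diagonal, krausOp_apply, star_krausOp_apply]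
      simp
    · intro p _ hp
      rw [highestWeightProj, mul_diagonal, if_neg (fun h : (p : ℕ) = 0 => hp (Fin.ext h)), mul_zero,
        zero_mul]
    · simp
  ext i j
  rw [reduce, Matrix.sum_apply, sum_congr rfl fun m _ => h1 m i j, sum_eq_single 0,
    Matrix.smul_apply, highestWeightProj, diagonal_apply, krausCoeff, krausCoeff]
  · by_cases hi : (i : ℕ) = 0
    · by_cases hj : (j : ℕ) = 0
      · rw [if_pos (by omega), if_pos (by omega), Real.mul_self_sqrt (by positivity),
          if_pos (Fin.ext (by omega)), if_pos hi]
        simp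
      · rw [if_neg (show ¬ 0 = (j : ℕ) + 0 by omega),
          if_neg (fun h : i = j => hj (by rw [← h, hi]))]
        simp
    · rw [if_neg (show ¬ 0 = (i : ℕ) + 0 by omega), if_neg hi]
      simp
  · intro m _ hm
    rw [krausCoeff, if_neg (by omega)]
    simp
  · simp

/-! ### Comparison of every output with the coherent output. -/

theorem TopSumLe.smul {n : Type*} [Fintype n] [DecidableEq n] {A : Matrix n n ℂ} {k : ℕ} {x c : ℝ}
    (h : TopSumLe A k x) (hc : 0 ≤ c) : TopSumLe ((c : ℂ) • A) k (c * x) := by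
  intro Q h1 h2 h3
  rw [Matrix.mul_smul, trace_smul, smul_eq_mul, Complex.re_ofReal_mul]
  exact mul_le_mul_of_nonneg_left (h Q h1 h2 h3) hc

theorem IsDensity.topSumLe_one {n : Type*} [Fintype n] [DecidableEq n] {A : Matrix n n ℂ}
    (h : IsDensity A) (k : ℕ) : TopSumLe A k 1 := by
  intro Q _ h2 _
  have h4 := trace_mul_re_nonneg h2 h.1
  rw [Matrix.sub_mul, Matrix.one_mul, trace_sub, h.2, Complex.sub_re, Complex.one_re] at h4
  linarith

/-- The output of a highest weight state is diagonal, and its entries majorize every output. -/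
theorem exists_channel_highestWeightProj (a b : ℕ) : ∃ y : ℕ → ℝ, (∀ i, 0 ≤ y i) ∧
    channel a b (highestWeightProj a) = diagonal (fun p : Fin (b + 1) => (y (b - p) : ℂ)) ∧
    ∀ ρ, IsDensity ρ → ∀ k, 1 ≤ k → TopSumLe (channel a b ρ) k (∑ i ∈ range k, y i) := by
  rcases le_total a b with hab | hab
  · refine ⟨fun i => ((b + 1).choose (b - a) : ℝ)⁻¹ * coherentWeight a b i,
      fun i => mul_nonneg (by positivity) (coherentWeight_nonneg a b i), ?_, fun ρ hρ k _ => ?_⟩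
    · rw [channel_of_le hab, reversal_highestWeightProj, amplify_lowestWeightProj hab,
        ← diagonal_smul]
      congr 1
      ext p
      simp
    · have h := (topSumLe_amplify hab (posSemidef_reversal hρ.1) k).smul
        (c := ((b + 1).choose (b - a) : ℝ)⁻¹) (by positivity)
      rw [trace_reversal, hρ.2, Complex.one_re, one_mul] at h
      rw [channel_of_le hab, ← mul_sum]
      convert h
      push_cast
      rfl
  -- The coherent output is pure, so every partial sum with `k ≥ 1` equals `1`, which bounds any
  -- density matrix.
  · refine ⟨fun i => if i = 0 then 1 else 0, fun i => by dsimp only; split_ifs <;> simp,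
      ?_, fun ρ hρ k hk => ?_⟩
    · have hN : (a.choose b : ℂ) ≠ 0 := by exact_mod_cast (Nat.choose_pos hab).ne'
      have h1 : reversal ((a.choose (a - b) : ℂ) • highestWeightProj b) =
          (a.choose b : ℂ) • reversal (highestWeightProj b) := by
        ext x y
        rw [Nat.choose_symm hab]
        simp only [reversal, of_apply, Matrix.smul_apply, smul_eq_mul]
        ring
      rw [channel_of_ge hab, reduce_highestWeightProj, h1, smul_smul, inv_mul_cancel₀ hN, one_smul,
        reversal_highestWeightProj]
      congr 1
      ext p
      have hp := p.2
      have h2 : (b - (p : ℕ) = 0) ↔ (p : ℕ) = b := by omega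
      dsimp only
      rw [if_congr h2 rfl rfl]
      split_ifs <;> simp
    · have h1 : ∑ i ∈ range k, (if i = 0 then (1 : ℝ) else 0) = 1 := by
        rw [sum_ite_eq' (range k), if_pos (mem_range.2 hk)]
      rw [h1]
      exact (isDensity_channel hρ).topSumLe_one k

theorem traceFun_channel_highestWeightProj_le {f : ℝ → ℝ} (hf : ConcaveOn ℝ (Set.Icc 0 1) f)
    {a : ℕ} (b : ℕ) {ρ : Matrix (Fin (a + 1)) (Fin (a + 1)) ℂ} (hρ : IsDensity ρ) :
    traceFun f (channel a b (highestWeightProj a)) ≤ traceFun f (channel a b ρ) := by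
  obtain ⟨y, hy0, hy, htop⟩ := exists_channel_highestWeightProj a b
  have hreflect : ∀ g : ℕ → ℝ, ∑ p : Fin (b + 1), g (b - p) = ∑ i ∈ range (b + 1), g i := by
    intro g
    rw [Fin.sum_univ_eq_sum_range (fun p => g (b - p))]
    exact sum_range_reflect g (b + 1)
  have hsum : ∑ i ∈ range (b + 1), y i = 1 := by
    have h := (isDensity_channel (b := b) (isDensity_highestWeightProj a)).2
    rw [hy, trace_diagonal] at h
    rw [← hreflect]
    exact_mod_cast h
  rw [hy, traceFun_diagonal f, hreflect (fun i => f (y i))]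
  refine (isDensity_channel hρ).traceFun_ge hf (fun i hi => ⟨hy0 i, ?_⟩) hsum
    fun k hk _ => htop ρ hρ k hk
  rw [← hsum]
  exact single_le_sum (f := y) (fun j _ => hy0 j) (mem_range.2 hi)

theorem concaveOn_neg_mul_log : ConcaveOn ℝ (Set.Icc 0 1) fun t : ℝ => -(t * log t) := by
  have h := concaveOn_negMulLog.subset (s := Set.Icc 0 1) (fun t ht => ht.1) (convex_Icc 0 1)
  refine h.congr fun t _ => ?_
  simp [negMulLog]

end

end SpinChannel

end

theorem corollary2p4 (a b : ℕ) :
    (∀ ω : Metric.sphere (0 : EuclideanSpace ℝ (Fin 3)) 1,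
      SpinChannel.IsDensity (SpinChannel.coherentProj a ω)) ∧
    (∀ ρ : Matrix (Fin (a + 1)) (Fin (a + 1)) ℂ,
      SpinChannel.IsDensity ρ → SpinChannel.IsDensity (SpinChannel.channel a b ρ)) ∧
    (∀ f : ℝ → ℝ, ConcaveOn ℝ (Set.Icc 0 1) f →
      ∀ ρ : Matrix (Fin (a + 1)) (Fin (a + 1)) ℂ, SpinChannel.IsDensity ρ →
        ∀ ω : Metric.sphere (0 : EuclideanSpace ℝ (Fin 3)) 1,
          SpinChannel.traceFun f (SpinChannel.channel a b ρ) ≥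
            SpinChannel.traceFun f (SpinChannel.channel a b (SpinChannel.coherentProj a ω))) ∧
    (∀ ω : Metric.sphere (0 : EuclideanSpace ℝ (Fin 3)) 1,
      IsLeast
        ((fun ρ => SpinChannel.entropy (SpinChannel.channel a b ρ)) ''
          {ρ : Matrix (Fin (a + 1)) (Fin (a + 1)) ℂ | SpinChannel.IsDensity ρ})
        (SpinChannel.entropy (SpinChannel.channel a b (SpinChannel.coherentProj a ω)))) := by
  have hmin : ∀ f : ℝ → ℝ, ConcaveOn ℝ (Set.Icc 0 1) f →
      ∀ ρ : Matrix (Fin (a + 1)) (Fin (a + 1)) ℂ, SpinChannel.IsDensity ρ →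
        ∀ ω : Metric.sphere (0 : EuclideanSpace ℝ (Fin 3)) 1,
          SpinChannel.traceFun f (SpinChannel.channel a b ρ) ≥
            SpinChannel.traceFun f (SpinChannel.channel a b (SpinChannel.coherentProj a ω)) := by
    intro f hf ρ hρ ω
    rw [SpinChannel.traceFun_channel_coherentProj]
    exact SpinChannel.traceFun_channel_highestWeightProj_le hf b hρ
  refine ⟨SpinChannel.isDensity_coherentProj a, fun ρ => SpinChannel.isDensity_channel, hmin,
    fun ω => ⟨⟨_, SpinChannel.isDensity_coherentProj a ω, rfl⟩, ?_⟩⟩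
  rintro _ ⟨ρ, hρ, rfl⟩
  exact hmin _ SpinChannel.concaveOn_neg_mul_log ρ hρ ω
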